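/- **Theorem (operator approximation under a Hölder-type Lipschitz assumption; American option pricing operator).** *Setting.* Let $d_1,d_2\ge 1$, $T>0$, and let $(\Omega,\mathcal F,(\mathcal F_t)_{t\in[0,T]},\mathbb P)$ be a filtered probability space satisfying the usual conditions. Let $X$ (with values in $\mathbb R^{d_1}$) and $X'$ (with values in $\mathbb R^{d_2}$) be progressively measurable processes with deterministic starting points $x$ and $x'$, such that for $(Y,y)=(X,x)$ and $(Y,y)=(X',x')$: * $\mathbb E[\sup_{0\le t\le T}|Y_t|^q]\le M_q<\infty$ for every $q>0$; * $\mathbb P(\sup_{0\le t\le T}|Y_t-y|\ge r)\le \exp(-c\,r^\alpha/C_T)$ for every $r>r_0$, where $\alpha,c,C_T>0$ and $r_0\ge 0$ are constants. For a process $Y$ write $\|f\|_{S^2(Y)}=\big(\mathbb E[\sup_{0\le t\le T}|f(Y_t)|^2]\big)^{1/2}$. Let $\mathcal G$ be a set of functions $g:\mathbb R^{d_1}\to\mathbb R$ such that $g(X_t)$ is progressively measurable, $\|g\|_{S^2(X)}<\infty$, $|g(y)|\le C_g(1+|y|^p)$ and $|g(y)-g(z)|\le L_g|y-z|$ for all $y,z$,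 with constants $C_g,p,L_g>0$ common to all $g\in\mathcal G$. Let $\mathcal U$ be a set of functions $u:\mathbb R^{d_2}\to\mathbb R$ such that $u(X'_t)$ is progressively measurable, $\|u\|_{S^2(X')}<\infty$ and $|u(y)-u(z)|\le L_u|y-z|$ for all $y,z$, with a common constant $L_u>0$. Let $L_\Gamma\ge 0$. *Networks.* $\mathcal F_{\rm NN}(d,1,\mathcal L,\mathfrak p,K,\kappa,R)$ denotes the functions $\mathbb R^d\to\mathbb R$ realized by a feedforward ReLU network with $\mathcal L$ layers, width at most $\mathfrak p$, at most $K$ nonzero weights and biases, all of them at most $\kappa$ in absolute value, and with values bounded by $R$. *Claim.* For every $\varepsilon>0$ there are positive integers $N_1$ and $N^\delta$, sample points $s_1,\dots,s_{N^\delta}\in\mathbb R^{d_1}$, classes $\mathcal F_1=\mathcal F_{\rm NN}(d_2,1,\mathcal L_1,\mathfrak p_1,K_1,\kappa_1,1)$ and $\mathcal F_2=\mathcal F_{\rm NN}(N^\delta,1,\mathcal L_2,w,K_2,\kappa_2,1)$, a positive integer $H$ and an integer $\mathfrak p_2\ge Hw$ ($w\ge 1$) such that the following holds. For every operator $\Gamma^A:\mathcal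 G\to\mathcal U$ with $$\|\Gamma^A(g_1)-\Gamma^A(g_2)\|_{S^2(X')}^2\le L_\Gamma^2\big(\|g_1-g_2\|_{S^2(X)}+\|g_1-g_2\|_{S^2(X)}^2\big)\qquad\text{for all }g_1,g_2\in\mathcal G,$$ there are trunk networks $\widetilde q_1,\dots,\widetilde q_{N_1}\in\mathcal F_1$ and branch networks $\widetilde a_k=\sum_{n=1}^{H}a_{k,n}\widetilde b_{k,n}$, $k=1,\dots,N_1$, with constants $a_{k,n}\in\mathbb R$ and $\widetilde b_{k,n}\in\mathcal F_2$, so that, with $\mathbf g=(g(s_1),\dots,g(s_{N^\delta}))$, $$\sup_{g\in\mathcal G}\mathbb E\Big[\sup_{0\le t\le T}\Big|\Gamma^A(g)(X'_t)-\sum_{k=1}^{N_1}\widetilde a_k(\mathbf g)\,\widetilde q_k(X'_t)\Big|\Big]\le\varepsilon .$$ Moreover, with $\varepsilon_1=\varepsilon/2$ and $\varepsilon_2=\varepsilon_1/(2N_1)$, for $0<\varepsilon\le\frac12$ the sizes satisfy $$N_1=O(\varepsilon^{-2d_2}),\qquad N^\delta=O(\varepsilon^{-4d_1d_2-2d_1}),$$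 $$\mathcal L_1,K_1=O\big((\tfrac12 d_2+2d_2^2)\log(\varepsilon_1^{-2})\big),\quad \mathfrak p_1=O(1),\quad \kappa_1=O(\varepsilon_1^{-2d_2}),$$ $$\mathcal L_2=O\big((N^\delta+\tfrac12(N^\delta)^2)\log N^\delta+(2(N^\delta)^2+N^\delta)\log\varepsilon^{-(2d_2+1)}\big),\quad \mathfrak p_2=O\big(\varepsilon_2^{-(4d_1-2)N^\delta}\big),$$ $$K_2=O\big((N^\delta+\tfrac12(N^\delta)^2)\log N^\delta+(2(N^\delta)^2+N^\delta)\log\varepsilon^{-2(d_2+1)}\big),\quad \kappa_2=O\big(\varepsilon^{-N^\delta(2d_2+1)}\big).$$ All constants hidden in $O(\cdot)$ depend only on $d_1,d_2,T,(M_q)_{q>0},\alpha,c,C_T,r_0,C_g,p,L_g,L_u,L_\Gamma$. -/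

import Mathlib

open MeasureTheory Set
open scoped ENNReal

/-! ### Feedforward ReLU networks -/

/-- A feedforward network with input dimension `n` and scalar output: either a final affine layer
`x ↦ W x + b`, or a hidden layer `x ↦ ReLU (W x + b)` with `m` neurons followed by a network. -/
inductive ReLUNet : ℕ → Type
  | last {n : ℕ} (W : Fin n → ℝ) (b : ℝ) : ReLUNet n
  | hidden {n : ℕ} (m : ℕ) (W : Matrix (Fin m) (Fin n) ℝ) (b : Fin m → ℝ)
      (rest : ReLUNet m) : ReLUNet n

namespace ReLUNet

/-- The function realized by the network. -/
noncomputable def eval : {n : ℕ} → ReLUNet n → (Fin n → ℝ) → ℝ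
  | _, last W b, x => (∑ i, W i * x i) + b
  | _, hidden _ W b rest, x => rest.eval (fun j => max ((∑ i, W j i * x i) + b j) 0)

/-- Number of layers (affine maps). -/
def depth : {n : ℕ} → ReLUNet n → ℕ
  | _, last _ _ => 1
  | _, hidden _ _ _ rest => rest.depth + 1

/-- Largest number of neurons in a hidden layer. -/
def width : {n : ℕ} → ReLUNet n → ℕ
  | _, last _ _ => 0
  | _, hidden m _ _ rest => max m rest.width

/-- Number of nonzero weights and biases, over all layers. -/
noncomputable def numNonzero : {n : ℕ} → ReLUNet n → ℕ
  | _, last W b => {i | W i ≠ 0}.ncard + {_u : Unit | b ≠ 0}.ncard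
  | n, hidden m W b rest =>
      {ij : Fin m × Fin n | W ij.1 ij.2 ≠ 0}.ncard + {j | b j ≠ 0}.ncard + rest.numNonzero

/-- All weights and biases are bounded by `κ` in absolute value. -/
def ParamsBounded (κ : ℝ) : {n : ℕ} → ReLUNet n → Prop
  | _, last W b => (∀ i, |W i| ≤ κ) ∧ |b| ≤ κ
  | _, hidden _ W b rest => (∀ j i, |W j i| ≤ κ) ∧ (∀ j, |b j| ≤ κ) ∧ rest.ParamsBounded κ

end ReLUNet

/-- The class `F_NN(d, m, L, p, K, κ, R)`: every component of `q` is a ReLU network with `L` layers,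
width at most `p`, at most `K` nonzero parameters, all parameters bounded by `κ`,
and values bounded by `R`. -/
def FNN (d m L p K : ℕ) (κ R : ℝ) : Set ((Fin d → ℝ) → (Fin m → ℝ)) :=
  {q | ∀ k : Fin m, ∃ net : ReLUNet d,
    (∀ x, q x k = net.eval x) ∧ net.depth = L ∧ net.width ≤ p ∧ net.numNonzero ≤ K ∧
    net.ParamsBounded κ ∧ ∀ x, |q x k| ≤ R}

/-! ### Expectations of suprema, state processes and the spaces of functions -/

section Stochastic

variable {Ω : Type*} [mΩ : MeasurableSpace Ω]

/-- Expectation of a nonnegative function. It is written as an upper integral, so that it makes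
sense for a supremum over uncountably many times before that is known to be measurable; it agrees
with the Lebesgue integral whenever the function is a.e. measurable, see
`expect_eq_lintegral`. -/
noncomputable def expect (P : Measure Ω) (f : Ω → ℝ≥0∞) : ℝ≥0∞ :=
  ⨅ (φ : Ω → ℝ≥0∞) (_ : Measurable φ) (_ : ∀ ω, f ω ≤ φ ω), ∫⁻ ω, φ ω ∂P

theorem expect_eq_lintegral {P : Measure Ω} {f : Ω → ℝ≥0∞} (hf : AEMeasurable f P) :
    expect P f = ∫⁻ ω, f ω ∂P := by
  classical
  apply le_antisymm
  · let s : Set Ω := toMeasurable P {ω | f ω ≠ hf.mk f ω}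
    have hs : MeasurableSet s := measurableSet_toMeasurable _ _
    have hs0 : P s = 0 := by
      rw [measure_toMeasurable]; exact hf.ae_eq_mk
    let φ : Ω → ℝ≥0∞ := s.piecewise (fun _ => ∞) (hf.mk f)
    have hφ : Measurable φ := Measurable.piecewise hs measurable_const hf.measurable_mk
    have hle : ∀ ω, f ω ≤ φ ω := by
      intro ω
      by_cases h : ω ∈ s
      · simp [φ, h]
      · have : f ω = hf.mk f ω := by
          by_contra hne
          exact h (subset_toMeasurable P _ hne)
        simp [φ, h, this]
    have heq : φ =ᵐ[P] f := by
      have h1 : ∀ᵐ ω ∂P, ω ∉ s := measure_eq_zero_iff_ae_notMem.1 hs0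
      filter_upwards [h1, hf.ae_eq_mk] with ω h h2
      simp [φ, h, h2]
    calc expect P f ≤ ∫⁻ ω, φ ω ∂P := iInf_le_of_le φ (iInf_le_of_le hφ (iInf_le _ hle))
      _ = ∫⁻ ω, f ω ∂P := lintegral_congr_ae heq
  · exact le_iInf fun φ => le_iInf fun _ => le_iInf fun h => lintegral_mono h

/-- The usual conditions: the filtration is right-continuous and contains all null sets. -/
def UsualConditions {T : ℝ} (P : Measure Ω) (𝓕 : Filtration (Icc (0 : ℝ) T) mΩ) : Prop :=
  𝓕.IsRightContinuous ∧ ∀ (t : Icc (0 : ℝ) T) (s : Set Ω), P s = 0 → MeasurableSet[𝓕 t] s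

/-- `E[sup_{0 ≤ t ≤ T} |f (X_t)|^q]`. -/
noncomputable def expectSup {T : ℝ} {d : ℕ} (P : Measure Ω)
    (X : Icc (0 : ℝ) T → Ω → EuclideanSpace ℝ (Fin d)) (q : ℝ)
    (f : EuclideanSpace ℝ (Fin d) → ℝ) : ℝ≥0∞ :=
  expect P fun ω => ⨆ t, ENNReal.ofReal |f (X t ω)| ^ q

/-- The norm `‖f‖_{S²} = (E[sup_{0 ≤ t ≤ T} |f (X_t)|²])^{1/2}`. -/
noncomputable def normS2 {T : ℝ} {d : ℕ} (P : Measure Ω)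
    (X : Icc (0 : ℝ) T → Ω → EuclideanSpace ℝ (Fin d))
    (f : EuclideanSpace ℝ (Fin d) → ℝ) : ℝ≥0∞ :=
  expectSup P X 2 f ^ (1 / 2 : ℝ)

/-- The functions `f` for which `f (X_t)` is progressively measurable and
`E[sup_{0 ≤ t ≤ T} |f (X_t)|²] < ∞`. -/
def spaceS2 {T : ℝ} {d : ℕ} (P : Measure Ω) (𝓕 : Filtration (Icc (0 : ℝ) T) mΩ)
    (X : Icc (0 : ℝ) T → Ω → EuclideanSpace ℝ (Fin d)) :
    Set (EuclideanSpace ℝ (Fin d) → ℝ) :=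
  {f | IsStronglyProgressive 𝓕 (fun t ω => f (X t ω)) ∧ normS2 P X f < ∞}

/-- A progressively measurable process started at `x`, with all moments of its supremum bounded by
`M p`, and with the tail bound `P(sup_t |X_t - x| ≥ r) ≤ exp (-c r^α / C_T)` for `r > r₀`. -/
structure IsStateProcess {T : ℝ} {d : ℕ} (P : Measure Ω) (𝓕 : Filtration (Icc (0 : ℝ) T) mΩ)
    (M : ℝ → ℝ) (α c CT r₀ : ℝ) (x : EuclideanSpace ℝ (Fin d))
    (X : Icc (0 : ℝ) T → Ω → EuclideanSpace ℝ (Fin d)) : Prop where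
  progressive : IsStronglyProgressive 𝓕 X
  start : ∀ t : Icc (0 : ℝ) T, (t : ℝ) = 0 → ∀ᵐ ω ∂P, X t ω = x
  moments : ∀ p : ℝ, 0 < p →
    expect P (fun ω => ⨆ t, ENNReal.ofReal ‖X t ω‖ ^ p) ≤ ENNReal.ofReal (M p)
  tail : ∀ r : ℝ, r₀ < r →
    P {ω | ENNReal.ofReal r ≤ ⨆ t, ENNReal.ofReal ‖X t ω - x‖} ≤
      ENNReal.ofReal (Real.exp (-(c * r ^ α / CT)))

end Stochastic

/-! ### Sizes of the operator network -/

/-- The size bounds, with `ε₁ = ε / 2`, `ε₂ = ε₁ / (2 N₁)`, and `C` the constant in every `O(·)`. -/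
structure SizeBounds (C : ℝ) (d₁ d₂ : ℕ) (ε ε₁ ε₂ : ℝ) (N₁ Nδ L₁ p₁ K₁ L₂ p₂ K₂ : ℕ)
    (κ₁ κ₂ : ℝ) : Prop where
  trunk_number : (N₁ : ℝ) ≤ C * ε ^ (-(2 * d₂ : ℝ))
  sample_number : (Nδ : ℝ) ≤ C * ε ^ (-(4 * d₁ * d₂ + 2 * d₁ : ℝ))
  trunk_depth : (L₁ : ℝ) ≤ C * ((1 / 2 * d₂ + 2 * d₂ ^ 2) * Real.log (ε₁ ^ (-2 : ℝ)))
  trunk_width : (p₁ : ℝ) ≤ C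
  trunk_params : (K₁ : ℝ) ≤ C * ((1 / 2 * d₂ + 2 * d₂ ^ 2) * Real.log (ε₁ ^ (-2 : ℝ)))
  trunk_weight : κ₁ ≤ C * ε₁ ^ (-(2 * d₂ : ℝ))
  branch_depth : (L₂ : ℝ) ≤ C * ((Nδ + 1 / 2 * Nδ ^ 2) * Real.log Nδ +
    (2 * Nδ ^ 2 + Nδ) * Real.log (ε ^ (-(2 * d₂ + 1 : ℝ))))
  branch_width : (p₂ : ℝ) ≤ C * ε₂ ^ (-((4 * d₁ - 2) * Nδ : ℝ))
  branch_params : (K₂ : ℝ) ≤ C * ((Nδ + 1 / 2 * Nδ ^ 2) * Real.log Nδ +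
    (2 * Nδ ^ 2 + Nδ) * Real.log (ε ^ (-(2 * (d₂ + 1) : ℝ))))
  branch_weight : κ₂ ≤ C * ε ^ (-(Nδ * (2 * d₂ + 1) : ℝ))

/-! The operator network is an exact ReLU realization of a two-level interpolation built from a
single function, the piecewise linear `hat`. Its integer translates form a partition of unity: the
value at `x` of the translate at `k` is the length of the set of diagonal shifts moving `x` into the
cell of `k`, and each shift moves `x` into exactly one cell (`volume_floor_eq`, `sum_hat_eq_one`).

At resolution `N`, input functions are sampled with spacing `N⁻²` on the box `[-N, N]^d₁`. The
branch functions are hats of scale `N⁻²` in the space of sample vectors, and each cell met by `𝒢`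
receives a representative in `𝒢`. Where the hat of a cell is positive at the samples of `g`, the
function `g` and the representative differ by `O(N⁻²) (1 + ‖y‖³)` (`abs_sub_le_of_samples`): by
Lipschitz continuity inside the box, by linear growth outside. The sixth moment turns this into an
`S²` distance `O(N⁻²)`, and the Hölder condition, whose linear term costs a square root, into a
distance `O(N⁻¹)` of the outputs. Hence the output of `g` is `O(N⁻¹)`-close to a convex combination
of outputs of representatives.

The trunk functions are hats of spacing `N⁻¹` on `[-N, N]^d₂`; they interpolate those outputs up to
`O(N⁻¹) (1 + ‖y‖²)` (`abs_sub_sum_hat_le`). Outputs have no common bound at the origin, so one fixed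
output value is subtracted before interpolating and restored by a constant trunk function. The
operator enters only through the coefficients (`exists_operator_network`), so architecture and
samples serve all operators, with `N` of order `1 / ε`. -/

/-! ### The hat function of the Freudenthal triangulation -/

/-- The maximum of `0` and the entries of a nonnegative vector, in the form in which a ReLU network
computes it. -/
noncomputable def reluMax : (n : ℕ) → (Fin n → ℝ) → ℝ
  | 0, _ => 0
  | n + 1, D => D 0 + reluMax n fun i => max (D i.succ - D 0) 0

/-- For `n ≥ 1` the recursion gives the true maximum, whatever the signs, because `D 0 + max (D i -
D 0) 0 = max (D i) (D 0)`. The clause for `n = 0` records the value `0` of an empty maximum. -/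
theorem reluMax_le_iff {n : ℕ} {D : Fin n → ℝ} {b : ℝ} :
    reluMax n D ≤ b ↔ (n = 0 → 0 ≤ b) ∧ ∀ i, D i ≤ b := by
  induction n generalizing b with
  | zero => simp [reluMax]
  | succ n ih =>
    have h : reluMax (n + 1) D ≤ b ↔ reluMax n (fun i => max (D i.succ - D 0) 0) ≤ b - D 0 := by
      rw [reluMax]; constructor <;> intro h <;> linarith
    rw [h, ih, Fin.forall_fin_succ]
    simp only [max_le_iff, sub_le_sub_iff_right, sub_nonneg]
    constructor
    · rintro ⟨h1, h2⟩
      refine ⟨by simp, ?_, fun i => (h2 i).1⟩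
      rcases n with _ | n
      · exact h1 rfl
      · exact (h2 0).2
    · rintro ⟨-, h1, h2⟩
      exact ⟨fun _ => h1, fun i => ⟨h2 i, h1⟩⟩

theorem reluMax_lt_iff {n : ℕ} {D : Fin n → ℝ} {b : ℝ} :
    reluMax n D < b ↔ (n = 0 → 0 < b) ∧ ∀ i, D i < b := by
  induction n generalizing b with
  | zero => simp [reluMax]
  | succ n ih =>
    have h : reluMax (n + 1) D < b ↔ reluMax n (fun i => max (D i.succ - D 0) 0) < b - D 0 := by
      rw [reluMax]; constructor <;> intro h <;> linarith
    rw [h, ih, Fin.forall_fin_succ]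
    simp only [max_lt_iff, sub_lt_sub_iff_right, sub_pos]
    constructor
    · rintro ⟨h1, h2⟩
      refine ⟨by simp, ?_, fun i => (h2 i).1⟩
      rcases n with _ | n
      · exact h1 rfl
      · exact (h2 0).2
    · rintro ⟨-, h1, h2⟩
      exact ⟨fun _ => h1, fun i => ⟨h2 i, h1⟩⟩

/-- The nodal basis function at the origin of the Freudenthal triangulation of `ℝⁿ`. -/
noncomputable def hat {n : ℕ} (y : Fin n → ℝ) : ℝ :=
  max (1 - (reluMax n (fun i => max (y i) 0) + reluMax n (fun i => max (-y i) 0))) 0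

theorem reluMax_nonneg {n : ℕ} {D : Fin n → ℝ} (hD : ∀ i, 0 ≤ D i) : 0 ≤ reluMax n D := by
  by_contra h
  rw [not_le, reluMax_lt_iff] at h
  rcases n with _ | n
  · exact lt_irrefl _ (h.1 rfl)
  · exact absurd (h.2 0) (not_lt.2 (hD 0))

theorem hat_nonneg {n : ℕ} (y : Fin n → ℝ) : 0 ≤ hat y := le_max_right _ _

theorem hat_le_one {n : ℕ} (y : Fin n → ℝ) : hat y ≤ 1 := by
  have h1 := reluMax_nonneg (D := fun i => max (y i) 0) fun i => le_max_right _ _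
  have h2 := reluMax_nonneg (D := fun i => max (-y i) 0) fun i => le_max_right _ _
  exact max_le (by linarith) zero_le_one

theorem hat_zero {n : ℕ} : hat (fun _ : Fin n => (0 : ℝ)) = 1 := by
  refine le_antisymm (hat_le_one _) (le_max_of_le_left ?_)
  have h : reluMax n (fun _ => (0 : ℝ)) ≤ 0 := reluMax_le_iff.2 ⟨fun _ => le_rfl, fun _ => le_rfl⟩
  simp only [neg_zero, max_self]
  linarith

theorem abs_lt_one_of_hat_pos {n : ℕ} {y : Fin n → ℝ} (h : 0 < hat y) (i : Fin n) :
    |y i| < 1 := by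
  have h1 := reluMax_nonneg (D := fun i => max (y i) 0) fun i => le_max_right _ _
  have h2 := reluMax_nonneg (D := fun i => max (-y i) 0) fun i => le_max_right _ _
  have h3 : 0 < 1 - (reluMax n (fun i => max (y i) 0) + reluMax n (fun i => max (-y i) 0)) := by
    simpa [hat] using h
  have h4 := (reluMax_lt_iff.1 (show reluMax n (fun i => max (y i) 0) < 1 by linarith)).2 i
  have h5 := (reluMax_lt_iff.1 (show reluMax n (fun i => max (-y i) 0) < 1 by linarith)).2 i
  rw [max_lt_iff] at h4 h5
  exact abs_lt.2 ⟨by linarith, h4.1⟩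

/-- The hat function centred at `k` is the length of the set of shifts `s ∈ [0, 1)` along the
diagonal that bring `x` into the unit cube with lower corner `k`. -/
theorem volume_floor_eq {n : ℕ} (x : Fin n → ℝ) (k : Fin n → ℤ) :
    volume {s : ℝ | s ∈ Ico (0 : ℝ) 1 ∧ ∀ i, ⌊x i + s⌋ = k i} =
      ENNReal.ofReal (hat fun i => x i - k i) := by
  -- The conditions read `-(x i - k i) ≤ s < 1 - (x i - k i)` together with `0 ≤ s < 1`, so the two
  -- maxima are the endpoints of a half-open interval.
  have hset : {s : ℝ | s ∈ Ico (0 : ℝ) 1 ∧ ∀ i, ⌊x i + s⌋ = k i} =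
      Ico (reluMax n (fun i => max (-(x i - k i)) 0))
        (1 - reluMax n (fun i => max (x i - k i) 0)) := by
    ext s
    have e : s < 1 - reluMax n (fun i => max (x i - k i) 0) ↔
        reluMax n (fun i => max (x i - k i) 0) < 1 - s := by
      constructor <;> intro h <;> linarith
    simp only [mem_ofPred_eq, mem_Ico, e, reluMax_le_iff, reluMax_lt_iff, max_le_iff, max_lt_iff,
      Int.floor_eq_iff]
    constructor
    · rintro ⟨⟨h0, h1⟩, h⟩
      exact ⟨⟨fun _ => h0, fun i => ⟨by linarith [(h i).1], h0⟩⟩,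
        ⟨fun _ => by linarith, fun i => ⟨by linarith [(h i).2], by linarith⟩⟩⟩
    · rintro ⟨⟨h0, h1⟩, h2, h3⟩
      refine ⟨?_, fun i => ⟨by linarith [(h1 i).1], by linarith [(h3 i).1]⟩⟩
      rcases n with _ | n
      · exact ⟨h0 rfl, by linarith [h2 rfl]⟩
      · exact ⟨(h1 0).2, by linarith [(h3 0).2]⟩
  rw [hset, Real.volume_Ico, hat, ENNReal.ofReal_max, ENNReal.ofReal_zero, max_eq_left zero_le]
  congr 1
  ring

/-- The points of `{-m, …, m}ⁿ`. -/
def latticePoint (m : ℕ) {n : ℕ} (k : Fin n → Fin (2 * m + 1)) (i : Fin n) : ℝ :=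
  ((k i : ℕ) : ℝ) - m

theorem abs_latticePoint_le (m : ℕ) {n : ℕ} (k : Fin n → Fin (2 * m + 1)) (i : Fin n) :
    |latticePoint m k i| ≤ m := by
  have h : ((k i : ℕ) : ℝ) ≤ 2 * m := by exact_mod_cast Nat.lt_succ_iff.1 (k i).2
  have h0 : (0 : ℝ) ≤ ((k i : ℕ) : ℝ) := Nat.cast_nonneg _
  rw [latticePoint, abs_le]
  constructor <;> linarith

/-- The sets of shifts for distinct `k` are disjoint, since a shift determines all the floors; their
lengths therefore add up. -/
theorem ofReal_sum_hat {n : ℕ} (m : ℕ) (x : Fin n → ℝ) :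
    ENNReal.ofReal (∑ k : Fin n → Fin (2 * m + 1), hat fun i => x i - latticePoint m k i) =
      volume (⋃ k : Fin n → Fin (2 * m + 1),
        {s : ℝ | s ∈ Ico (0 : ℝ) 1 ∧ ∀ i, ⌊x i + s⌋ = ((k i : ℕ) : ℤ) - m}) := by
  rw [measure_iUnion, tsum_fintype, ENNReal.ofReal_sum_of_nonneg fun k _ => hat_nonneg _]
  · refine Finset.sum_congr rfl fun k _ => ?_
    rw [volume_floor_eq]
    simp [latticePoint]
  · intro k l hkl
    refine Set.disjoint_left.2 fun s hs hs' => hkl ?_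
    ext i
    have h1 := hs.2 i
    have h2 := hs'.2 i
    omega
  · intro k
    have : {s : ℝ | s ∈ Ico (0 : ℝ) 1 ∧ ∀ i, ⌊x i + s⌋ = ((k i : ℕ) : ℤ) - m} =
        Ico (0 : ℝ) 1 ∩ ⋂ i, (fun s : ℝ => ⌊x i + s⌋) ⁻¹' {((k i : ℕ) : ℤ) - m} := by
      ext s; simp
    rw [this]
    exact measurableSet_Ico.inter <| MeasurableSet.iInter fun i =>
      (Int.measurable_floor.comp (measurable_const_add (x i))) (measurableSet_singleton _)

theorem sum_hat_le_one {n : ℕ} (m : ℕ) (x : Fin n → ℝ) :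
    ∑ k : Fin n → Fin (2 * m + 1), hat (fun i => x i - latticePoint m k i) ≤ 1 := by
  rw [← ENNReal.ofReal_le_ofReal_iff zero_le_one, ofReal_sum_hat]
  calc _ ≤ volume (Ico (0 : ℝ) 1) := measure_mono (iUnion_subset fun k s hs => hs.1)
    _ = ENNReal.ofReal 1 := by simp

theorem exists_coe_sub_eq (m : ℕ) {z : ℤ} (h1 : -(m : ℤ) ≤ z) (h2 : z ≤ m) :
    ∃ j : Fin (2 * m + 1), ((j : ℕ) : ℤ) - m = z :=
  ⟨⟨(z + m).toNat, by omega⟩, by simp; omega⟩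

/-- From `|x i| ≤ m` and `0 ≤ s < 1` follows `-m ≤ ⌊x i + s⌋ ≤ m`, so every shift is counted. The
strict bound `s < 1` is what makes `{-m, …, m}` sufficient. -/
theorem sum_hat_eq_one {n : ℕ} (m : ℕ) (x : Fin n → ℝ) (hx : ∀ i, |x i| ≤ m) :
    ∑ k : Fin n → Fin (2 * m + 1), hat (fun i => x i - latticePoint m k i) = 1 := by
  refine le_antisymm (sum_hat_le_one m x) ?_
  rw [← ENNReal.ofReal_le_ofReal_iff (Finset.sum_nonneg fun k _ => hat_nonneg _), ofReal_sum_hat]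
  calc ENNReal.ofReal 1 = volume (Ico (0 : ℝ) 1) := by simp
    _ ≤ _ := measure_mono fun s hs => ?_
  have h : ∀ i, ∃ j : Fin (2 * m + 1), ((j : ℕ) : ℤ) - m = ⌊x i + s⌋ := fun i => by
    have := abs_le.1 (hx i)
    refine exists_coe_sub_eq m (Int.le_floor.2 ?_) (Int.lt_add_one_iff.1 (Int.floor_lt.2 ?_))
    · push_cast; linarith [hs.1]
    · push_cast; linarith [hs.2]
  choose k hk using h
  exact mem_iUnion.2 ⟨k, hs, fun i => (hk i).symm⟩

/-! ### A ReLU network for the hat function -/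

/-- `f` is realized by a ReLU network of the given size, for every enumeration of the inputs. -/
def IsReLURealized {ι : Type} (f : (ι → ℝ) → ℝ) (L w K : ℕ) (κ : ℝ) : Prop :=
  ∀ (m : ℕ) (e : ι ≃ Fin m), ∃ net : ReLUNet m, (∀ x, net.eval (x ∘ e.symm) = f x) ∧
    net.depth = L ∧ net.width ≤ w ∧ net.numNonzero ≤ K ∧ net.ParamsBounded κ

theorem ncard_nonzero_le {ι τ : Type} {m n : ℕ} (e : ι ≃ Fin m) (e' : τ ≃ Fin n)
    (W : τ → ι → ℝ) (r : ℕ) (hr : ∀ j, ∃ S : Finset ι, S.card ≤ r ∧ ∀ i ∉ S, W j i = 0) :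
    {ji : Fin n × Fin m | W (e'.symm ji.1) (e.symm ji.2) ≠ 0}.ncard ≤ n * r := by
  classical
  choose S hS hW using hr
  have hsub : {ji : Fin n × Fin m | W (e'.symm ji.1) (e.symm ji.2) ≠ 0} ⊆
      ↑(Finset.univ.biUnion fun j : Fin n => (S (e'.symm j)).image fun i => (j, e i)) := by
    rintro ⟨j, i⟩ h
    simp only [Finset.coe_biUnion, mem_iUnion, Finset.coe_image]
    refine ⟨j, by simp, e.symm i, ?_, by simp⟩
    by_contra hi
    exact h (hW _ _ hi)
  calc _ ≤ _ := Set.ncard_le_ncard hsub (Finset.finite_toSet _)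
    _ = _ := Set.ncard_coe_finset _
    _ ≤ Finset.univ.card * r := Finset.card_biUnion_le_card_mul _ _ _ fun j _ =>
        Finset.card_image_le.trans (hS _)
    _ = n * r := by simp

theorem ncard_le_of_fin {n : ℕ} (s : Set (Fin n)) : s.ncard ≤ n := by
  simpa using Set.ncard_le_card s

/-- Adding a hidden layer whose neurons have at most three inputs each. -/
theorem IsReLURealized.hidden {ι τ : Type} [Fintype ι] [Fintype τ] {f : (τ → ℝ) → ℝ}
    {L w K : ℕ} {κ : ℝ} (hf : IsReLURealized f L w K κ) (W : τ → ι → ℝ) (b : τ → ℝ)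
    (hr : ∀ j, ∃ S : Finset ι, S.card ≤ 3 ∧ ∀ i ∉ S, W j i = 0)
    (hW : ∀ j i, |W j i| ≤ κ) (hb : ∀ j, |b j| ≤ κ) :
    IsReLURealized (fun x => f fun j => max ((∑ i, W j i * x i) + b j) 0)
      (L + 1) (max (Fintype.card τ) w) (4 * Fintype.card τ + K) κ := by
  intro m e
  let e' := Fintype.equivFin τ
  obtain ⟨net, h1, h2, h3, h4, h5⟩ := hf _ e'
  refine ⟨.hidden (Fintype.card τ) (fun j i => W (e'.symm j) (e.symm i)) (fun j => b (e'.symm j))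
    net, fun x => ?_, ?_, ?_, ?_, ?_⟩
  · beta_reduce
    rw [← h1]
    change net.eval _ = _
    congr 1
    funext j
    simp only [Function.comp]
    rw [Equiv.sum_comp e.symm fun i => W (e'.symm j) i * x i]
  · exact congrArg (· + 1) h2
  · exact max_le_max le_rfl h3
  · change _ + _ + net.numNonzero ≤ _
    have h6 := ncard_nonzero_le e e' W 3 hr
    have h7 := ncard_le_of_fin {j | b (e'.symm j) ≠ 0}
    beta_reduce
    omega
  · exact ⟨fun j i => hW _ _, fun j => hb _, h5⟩

/-- The last layers of the network for the hat function: given an accumulated value and two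
nonnegative vectors, subtract the value and both maxima from `1` and take the positive part. -/
noncomputable def hatTail : (n : ℕ) → (Option (Fin n ⊕ Fin n) → ℝ) → ℝ
  | 0, x => max (1 - x none) 0
  | n + 1, x => hatTail n fun
    | none => max (x none + x (some (.inl 0)) + x (some (.inr 0))) 0
    | some (.inl i) => max (x (some (.inl i.succ)) - x (some (.inl 0))) 0
    | some (.inr i) => max (x (some (.inr i.succ)) - x (some (.inr 0))) 0

/-- Nonnegativity lets the accumulator pass through each ReLU unchanged. -/
theorem hatTail_eq (n : ℕ) (x : Option (Fin n ⊕ Fin n) → ℝ) (hx : ∀ i, 0 ≤ x i) :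
    hatTail n x = max (1 - (x none + reluMax n (fun i => x (some (.inl i))) +
      reluMax n (fun i => x (some (.inr i))))) 0 := by
  induction n with
  | zero => simp [hatTail, reluMax]
  | succ n ih =>
    rw [hatTail, ih]
    · have h := add_nonneg (add_nonneg (hx none) (hx (some (.inl 0)))) (hx (some (.inr 0)))
      simp only [reluMax, max_eq_left h]
      congr 1
      ring
    · rintro (_ | i | i) <;> exact le_max_right _ _

/-- Each layer moves the leading entry of both vectors into the accumulator and replaces the other
entries by positive parts of differences. No neuron has more than three inputs, which keeps the
parameter count quadratic in `n`. -/
theorem isReLURealized_hatTail (n : ℕ) {κ : ℝ} (hκ : 1 ≤ κ) :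
    IsReLURealized (hatTail n) (n + 2) (2 * n + 1) (4 * (2 * n + 1) * n + 6) κ := by
  have hκ0 : 0 ≤ κ := zero_le_one.trans hκ
  induction n with
  | zero =>
    have hlast : IsReLURealized (fun x : Unit → ℝ => x ()) 1 1 2 κ := by
      intro m e
      refine ⟨.last (fun _ => 1) 0, fun x => ?_, rfl, ?_, ?_, ?_⟩
      · simp only [ReLUNet.eval, Function.comp, one_mul, add_zero]
        rw [Equiv.sum_comp e.symm x]
        simp
      · simp [ReLUNet.width]
      · have hm : m = 1 := by simpa using (Fintype.card_congr e).symm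
        have := ncard_le_of_fin {i : Fin m | (1 : ℝ) ≠ 0}
        have h2 : {_u : Unit | (0 : ℝ) ≠ 0}.ncard ≤ 1 := by simp
        rw [ReLUNet.numNonzero]
        omega
      · simpa [ReLUNet.ParamsBounded, hκ0] using fun _ => hκ
    have h := hlast.hidden (ι := Option (Fin 0 ⊕ Fin 0)) (fun _ _ => -1) (fun _ => 1)
      (fun _ => ⟨{none}, by simp, by rintro (_ | i | i) <;> simp <;> exact i.elim0⟩)
      (fun _ _ => by simpa using hκ) (by simpa using hκ)
    rw [Fintype.card_unit, max_self] at h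
    convert h using 1
    funext x
    simp only [hatTail, Fintype.sum_option, Finset.univ_eq_empty, Finset.sum_empty]
    congr 1
    ring
  | succ n ih =>
    let W : Option (Fin n ⊕ Fin n) → Option (Fin (n + 1) ⊕ Fin (n + 1)) → ℝ := fun
      | none, none => 1
      | none, some (.inl i) => if i = 0 then 1 else 0
      | none, some (.inr i) => if i = 0 then 1 else 0
      | some (.inl j), some (.inl i) => if i = j.succ then 1 else if i = 0 then -1 else 0
      | some (.inr j), some (.inr i) => if i = j.succ then 1 else if i = 0 then -1 else 0
      | some (.inl _), none => 0
      | some (.inl _), some (.inr _) => 0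
      | some (.inr _), none => 0
      | some (.inr _), some (.inl _) => 0
    have hr : ∀ j, ∃ S : Finset (Option (Fin (n + 1) ⊕ Fin (n + 1))),
        S.card ≤ 3 ∧ ∀ i ∉ S, W j i = 0 := by
      classical
      rintro (_ | j | j)
      · refine ⟨{none, some (.inl 0), some (.inr 0)}, Finset.card_le_three, ?_⟩
        rintro (_ | i | i) hi <;> simp_all [W]
      · refine ⟨{some (.inl j.succ), some (.inl 0)}, Finset.card_le_two.trans (by norm_num), ?_⟩
        rintro (_ | i | i) hi <;> simp_all [W]
      · refine ⟨{some (.inr j.succ), some (.inr 0)}, Finset.card_le_two.trans (by norm_num), ?_⟩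
        rintro (_ | i | i) hi <;> simp_all [W]
    have hW : ∀ j i, |W j i| ≤ κ := by
      rintro (_ | j | j) (_ | i | i) <;> simp only [W] <;> (try split_ifs) <;> simp [hκ, hκ0]
    have h := ih.hidden W (fun _ => 0) hr hW (by simpa using hκ0)
    intro m e
    obtain ⟨net, h1, h2, h3, h4, h5⟩ := h m e
    refine ⟨net, fun x => ?_, h2, h3.trans ?_, h4.trans ?_, h5⟩
    · rw [h1, hatTail]
      beta_reduce
      congr 1
      funext j
      rcases j with _ | j | j
      · simp [W, Fintype.sum_option, Fintype.sum_sum_type, add_assoc]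
      · simp [W, Fintype.sum_option, Fintype.sum_sum_type, Fin.sum_univ_succ, Fin.succ_ne_zero,
          (Fin.succ_ne_zero _).symm, sub_eq_add_neg, add_comm]
      · simp [W, Fintype.sum_option, Fintype.sum_sum_type, Fin.sum_univ_succ, Fin.succ_ne_zero,
          (Fin.succ_ne_zero _).symm, sub_eq_add_neg, add_comm]
    · simp only [Fintype.card_option, Fintype.card_sum, Fintype.card_fin]
      omega
    · simp only [Fintype.card_option, Fintype.card_sum, Fintype.card_fin]
      nlinarith

/-- The network for a scaled and translated hat function. -/
theorem exists_net_hat (n : ℕ) {κ l : ℝ} {k : Fin n → ℝ} (hκ : 1 ≤ κ) (hl : |l| ≤ κ)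
    (hk : ∀ i, |k i| ≤ κ) :
    ∃ net : ReLUNet n, (∀ x, net.eval x = hat fun i => l * x i - k i) ∧ net.depth = n + 3 ∧
      net.width ≤ 2 * n + 1 ∧ net.numNonzero ≤ 4 * (2 * n + 1) * (n + 1) + 6 ∧
      net.ParamsBounded κ := by
  have hκ0 : 0 ≤ κ := zero_le_one.trans hκ
  -- The first layer splits `l * x i - k i` into positive and negative parts and starts the
  -- accumulator at `0`.
  let W : Option (Fin n ⊕ Fin n) → Fin n → ℝ := fun
    | none, _ => 0
    | some (.inl j), i => if i = j then l else 0
    | some (.inr j), i => if i = j then -l else 0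
  let b : Option (Fin n ⊕ Fin n) → ℝ := fun
    | none => 0
    | some (.inl j) => -k j
    | some (.inr j) => k j
  have hr : ∀ j, ∃ S : Finset (Fin n), S.card ≤ 3 ∧ ∀ i ∉ S, W j i = 0 := by
    rintro (_ | j | j)
    · exact ⟨∅, by simp, fun i _ => rfl⟩
    · exact ⟨{j}, by simp, fun i hi => by simp_all [W]⟩
    · exact ⟨{j}, by simp, fun i hi => by simp_all [W]⟩
  have hW : ∀ j i, |W j i| ≤ κ := by
    rintro (_ | j | j) i <;> simp only [W] <;> (try split_ifs) <;> simp [hl, hκ0]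
  have hb : ∀ j, |b j| ≤ κ := by
    rintro (_ | j | j) <;> simp [b, hk, hκ0]
  obtain ⟨net, h1, h2, h3, h4, h5⟩ :=
    (isReLURealized_hatTail n hκ).hidden W b hr hW hb n (Equiv.refl _)
  refine ⟨net, fun x => ?_, h2, h3.trans ?_, h4.trans ?_, h5⟩
  · have := h1 x
    simp only [Equiv.refl_symm, Equiv.coe_refl, Function.comp_id] at this
    rw [this, hatTail_eq _ _ fun i => le_max_right _ _]
    simp [W, b, hat, sub_eq_add_neg, add_comm]
  · simp only [Fintype.card_option, Fintype.card_sum, Fintype.card_fin]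
    omega
  · simp only [Fintype.card_option, Fintype.card_sum, Fintype.card_fin]
    nlinarith

theorem hat_mem_FNN (n : ℕ) {κ l : ℝ} {k : Fin n → ℝ} (hκ : 1 ≤ κ) (hl : |l| ≤ κ)
    (hk : ∀ i, |k i| ≤ κ) :
    (fun (x : Fin n → ℝ) (_ : Fin 1) => hat fun i => l * x i - k i) ∈
      FNN n 1 (n + 3) (2 * n + 1) (4 * (2 * n + 1) * (n + 1) + 6) κ 1 := by
  intro _
  obtain ⟨net, h1, h2, h3, h4, h5⟩ := exists_net_hat n hκ hl hk
  exact ⟨net, fun x => (h1 x).symm, h2, h3, h4, h5, fun x => by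
    rw [abs_of_nonneg (hat_nonneg _)]; exact hat_le_one _⟩

/-! ### Expectations of suprema -/

section Expectation

variable {Ω : Type*} [mΩ : MeasurableSpace Ω] {P : Measure Ω}

theorem expect_le_lintegral {f φ : Ω → ℝ≥0∞} (hφ : Measurable φ) (h : ∀ ω, f ω ≤ φ ω) :
    expect P f ≤ ∫⁻ ω, φ ω ∂P :=
  iInf_le_of_le φ (iInf_le_of_le hφ (iInf_le _ h))

theorem expect_mono {f g : Ω → ℝ≥0∞} (h : ∀ ω, f ω ≤ g ω) : expect P f ≤ expect P g :=
  le_iInf fun _ => le_iInf fun hφ => le_iInf fun hg =>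
    expect_le_lintegral hφ fun ω => (h ω).trans (hg ω)

theorem exists_lintegral_le_expect_add {f : Ω → ℝ≥0∞} (h : expect P f ≠ ∞) {δ : ℝ≥0∞}
    (hδ : δ ≠ 0) :
    ∃ φ : Ω → ℝ≥0∞, Measurable φ ∧ (∀ ω, f ω ≤ φ ω) ∧ ∫⁻ ω, φ ω ∂P < expect P f + δ := by
  have hlt := ENNReal.lt_add_right h hδ
  simp only [expect, iInf_lt_iff] at hlt ⊢
  obtain ⟨φ, h1, h2, h3⟩ := hlt
  exact ⟨φ, h1, h2, h3⟩

/-- Measurable majorants of the summands add up to one of the sum, so upper integrals are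
subadditive without any measurability of the suprema. The error estimates rest on this. -/
theorem expect_add_le (f g : Ω → ℝ≥0∞) :
    expect P (fun ω => f ω + g ω) ≤ expect P f + expect P g := by
  by_cases hf : expect P f = ∞
  · simp [hf]
  by_cases hg : expect P g = ∞
  · simp [hg]
  refine ENNReal.le_of_forall_pos_le_add fun δ hδ _ => ?_
  have hδ' : ((δ / 2 : NNReal) : ℝ≥0∞) ≠ 0 := by simpa using hδ.ne'
  obtain ⟨φ, h1, h2, h3⟩ := exists_lintegral_le_expect_add hf hδ'
  obtain ⟨ψ, h4, h5, h6⟩ := exists_lintegral_le_expect_add hg hδ'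
  calc expect P (fun ω => f ω + g ω) ≤ ∫⁻ ω, φ ω + ψ ω ∂P :=
        expect_le_lintegral (h1.add h4) fun ω => add_le_add (h2 ω) (h5 ω)
    _ = ∫⁻ ω, φ ω ∂P + ∫⁻ ω, ψ ω ∂P := lintegral_add_left h1 _
    _ ≤ (expect P f + (δ / 2 : NNReal)) + (expect P g + (δ / 2 : NNReal)) :=
        add_le_add h3.le h6.le
    _ = expect P f + expect P g + δ := by
        rw [add_add_add_comm, ← ENNReal.coe_add, add_halves]

theorem expect_const_mul_le (c : ℝ≥0∞) (f : Ω → ℝ≥0∞) (hc : c ≠ ∞) :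
    expect P (fun ω => c * f ω) ≤ c * expect P f := by
  rcases eq_or_ne c 0 with rfl | hc0
  · simpa using expect_le_lintegral (P := P) (f := fun _ => 0) measurable_const fun _ => le_rfl
  · conv_rhs => rw [expect]
    simp only [ENNReal.mul_iInf_of_ne hc0 hc]
    refine le_iInf fun φ => le_iInf fun hφ => le_iInf fun hf => ?_
    rw [← lintegral_const_mul c hφ]
    exact expect_le_lintegral (hφ.const_mul c) fun ω => mul_le_mul_right (hf ω) c

theorem expect_sum_le {ι : Type*} (s : Finset ι) (f : ι → Ω → ℝ≥0∞) :
    expect P (fun ω => ∑ i ∈ s, f i ω) ≤ ∑ i ∈ s, expect P (f i) := by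
  classical
  induction s using Finset.induction_on with
  | empty =>
    simpa using expect_le_lintegral (P := P) (f := fun _ => 0) measurable_const fun _ => le_rfl
  | insert i s hi ih =>
    simp only [Finset.sum_insert hi]
    exact (expect_add_le _ _).trans (add_le_add le_rfl ih)

theorem expect_const_le [IsProbabilityMeasure P] (c : ℝ≥0∞) : expect P (fun _ => c) ≤ c := by
  simpa using expect_le_lintegral (P := P) (f := fun _ => c) measurable_const fun _ => le_rfl

theorem le_expect [IsProbabilityMeasure P] {c : ℝ≥0∞} {f : Ω → ℝ≥0∞} (h : ∀ ω, c ≤ f ω) :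
    c ≤ expect P f :=
  le_iInf fun φ => le_iInf fun _ => le_iInf fun hφ =>
    calc c = ∫⁻ _, c ∂P := by simp
      _ ≤ ∫⁻ ω, φ ω ∂P := lintegral_mono fun ω => (h ω).trans (hφ ω)

/-- Cauchy–Schwarz against the constant `1`, applied to the square root of a measurable majorant of
`g`. -/
theorem expect_le_sqrt [IsProbabilityMeasure P] {f g : Ω → ℝ≥0∞}
    (h : ∀ ω, f ω ^ (2 : ℝ) ≤ g ω) : expect P f ≤ expect P g ^ (1 / 2 : ℝ) := by
  rw [one_div, ENNReal.le_rpow_inv_iff two_pos]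
  refine le_iInf fun φ => le_iInf fun hφ => le_iInf fun hg => ?_
  rw [← ENNReal.le_rpow_inv_iff two_pos, ← one_div]
  calc expect P f ≤ ∫⁻ ω, φ ω ^ (1 / 2 : ℝ) ∂P := by
        refine expect_le_lintegral (hφ.pow_const _) fun ω => ?_
        rw [one_div, ENNReal.le_rpow_inv_iff two_pos]
        exact (h ω).trans (hg ω)
    _ ≤ (∫⁻ ω, φ ω ∂P) ^ (1 / 2 : ℝ) := by
        have := ENNReal.lintegral_mul_le_Lp_mul_Lq P Real.HolderConjugate.two_two
          (hφ.pow_const (1 / 2 : ℝ)).aemeasurable (g := fun _ => 1) aemeasurable_const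
        have e : ∀ ω, (φ ω ^ (1 / 2 : ℝ)) ^ (2 : ℝ) = φ ω := fun ω => by
          rw [← ENNReal.rpow_mul]; norm_num
        simp only [e] at this
        simpa using this

variable {T : ℝ} {d : ℕ} {X : Icc (0 : ℝ) T → Ω → EuclideanSpace ℝ (Fin d)}
  {f : EuclideanSpace ℝ (Fin d) → ℝ}

theorem expectSup_one_le_normS2 [IsProbabilityMeasure P] : expectSup P X 1 f ≤ normS2 P X f := by
  refine expect_le_sqrt fun ω => ?_
  rw [← ENNReal.orderIsoRpow_apply 2 two_pos, OrderIso.map_iSup]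
  simp

/-- A growth bound for `f` and a moment bound for the process bound the moments of `f`. -/
theorem expectSup_le_of_growth [IsProbabilityMeasure P] {q r a m : ℝ} (hq : 0 ≤ q) (hr : 0 ≤ r)
    (ha : 0 ≤ a) (h : ∀ y, |f y| ^ q ≤ a * (1 + ‖y‖ ^ r))
    (hm : expect P (fun ω => ⨆ t, ENNReal.ofReal ‖X t ω‖ ^ r) ≤ ENNReal.ofReal m) :
    expectSup P X q f ≤ ENNReal.ofReal (a * (1 + |m|)) := by
  calc expectSup P X q f
      ≤ expect P fun ω => ENNReal.ofReal a * (1 + ⨆ t, ENNReal.ofReal ‖X t ω‖ ^ r) := by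
        refine expect_mono fun ω => iSup_le fun t => ?_
        rw [ENNReal.ofReal_rpow_of_nonneg (abs_nonneg _) hq]
        refine (ENNReal.ofReal_le_ofReal (h _)).trans ?_
        rw [ENNReal.ofReal_mul ha, ENNReal.ofReal_add zero_le_one (by positivity),
          ENNReal.ofReal_one, ← ENNReal.ofReal_rpow_of_nonneg (norm_nonneg _) hr]
        gcongr
        exact le_iSup (fun t => ENNReal.ofReal ‖X t ω‖ ^ r) t
    _ ≤ ENNReal.ofReal a * (1 + ENNReal.ofReal m) := by
        refine (expect_const_mul_le _ _ ENNReal.ofReal_ne_top).trans ?_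
        gcongr
        exact (expect_add_le _ _).trans (add_le_add (expect_const_le 1) hm)
    _ ≤ ENNReal.ofReal a * (1 + ENNReal.ofReal |m|) := by
        gcongr
        exact le_abs_self m
    _ = ENNReal.ofReal (a * (1 + |m|)) := by
        rw [ENNReal.ofReal_mul ha, ENNReal.ofReal_add zero_le_one (abs_nonneg m),
          ENNReal.ofReal_one]

theorem normS2_le_of_cubic_growth [IsProbabilityMeasure P] {a m : ℝ} (ha : 0 ≤ a)
    (h : ∀ y, |f y| ≤ a * (1 + ‖y‖ ^ 3))
    (hm : expect P (fun ω => ⨆ t, ENNReal.ofReal ‖X t ω‖ ^ (6 : ℝ)) ≤ ENNReal.ofReal m) :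
    normS2 P X f ≤ ENNReal.ofReal (2 * a * (1 + |m|)) := by
  have h2 : expectSup P X 2 f ≤ ENNReal.ofReal (2 * a ^ 2 * (1 + |m|)) := by
    refine expectSup_le_of_growth (by norm_num) (by norm_num) (by positivity) (fun y => ?_) hm
    have e : ‖y‖ ^ (6 : ℝ) = (‖y‖ ^ 3) ^ 2 := by rw [← pow_mul]; norm_cast
    rw [e, Real.rpow_two]
    calc |f y| ^ 2 ≤ (a * (1 + ‖y‖ ^ 3)) ^ 2 := pow_le_pow_left₀ (abs_nonneg _) (h y) 2
      _ ≤ 2 * a ^ 2 * (1 + (‖y‖ ^ 3) ^ 2) := by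
        nlinarith [mul_nonneg (sq_nonneg a) (sq_nonneg (1 - ‖y‖ ^ 3))]
  rw [normS2, one_div, ENNReal.rpow_inv_le_iff two_pos,
    ENNReal.ofReal_rpow_of_nonneg (by positivity) (by norm_num), Real.rpow_two]
  -- Since `1 + |m| ≥ 1`, the square of `2 * a * (1 + |m|)` dominates; coarsening the constant
  -- avoids a square root of the moment.
  refine h2.trans (ENNReal.ofReal_le_ofReal ?_)
  have : 0 ≤ a ^ 2 * (1 + |m|) := by positivity
  nlinarith [mul_nonneg this (abs_nonneg m)]

end Expectation

/-- The Hölder-type condition turns closeness of order `N⁻²` into closeness of order `N⁻¹`. -/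
theorem le_of_sq_le_add_sq {s n : ℝ≥0∞} {l κ N : ℝ} (hl : 0 ≤ l) (hκ : 0 ≤ κ) (hN : 1 ≤ N)
    (hs : s ^ 2 ≤ ENNReal.ofReal (l ^ 2) * (n + n ^ 2)) (hn : n ≤ ENNReal.ofReal (κ / N ^ 2)) :
    s ≤ ENNReal.ofReal (l * (1 + κ) / N) := by
  have hN0 : 0 < N := by linarith
  rw [← ENNReal.pow_le_pow_left_iff two_ne_zero]
  calc s ^ 2 ≤ ENNReal.ofReal (l ^ 2) *
        (ENNReal.ofReal (κ / N ^ 2) + ENNReal.ofReal (κ / N ^ 2) ^ 2) := hs.trans (by gcongr)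
    _ = ENNReal.ofReal (l ^ 2 * (κ / N ^ 2 + (κ / N ^ 2) ^ 2)) := by
        rw [ENNReal.ofReal_mul (by positivity), ENNReal.ofReal_add (by positivity) (by positivity),
          ENNReal.ofReal_pow (p := κ / N ^ 2) (by positivity)]
    _ ≤ ENNReal.ofReal ((l * (1 + κ) / N) ^ 2) := by
        refine ENNReal.ofReal_le_ofReal ?_
        -- As `N ≥ 1`, the quadratic term is absorbed and the linear term fixes the rate.
        have h1 : (κ / N ^ 2) ^ 2 ≤ κ ^ 2 / N ^ 2 := by
          rw [div_pow]
          exact div_le_div_of_nonneg_left (by positivity) (by positivity)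
            (by nlinarith [one_le_pow₀ (n := 2) hN])
        have h2 : (l * (1 + κ) / N) ^ 2 = l ^ 2 * ((1 + κ) ^ 2 / N ^ 2) := by ring
        rw [h2]
        gcongr
        calc κ / N ^ 2 + (κ / N ^ 2) ^ 2 ≤ κ / N ^ 2 + κ ^ 2 / N ^ 2 := by linarith
          _ = (κ + κ ^ 2) / N ^ 2 := by ring
          _ ≤ _ := by gcongr; nlinarith
    _ = _ := ENNReal.ofReal_pow (by positivity) 2

/-! ### Interpolation and sampling of Lipschitz functions on lattices -/

theorem norm_le_of_abs_le {d : ℕ} {y : EuclideanSpace ℝ (Fin d)} {b : ℝ} (hb : 0 ≤ b)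
    (h : ∀ i, |y i| ≤ b) : ‖y‖ ≤ d * b := by
  rw [EuclideanSpace.norm_eq, Real.sqrt_le_left (by positivity)]
  calc ∑ i, ‖y i‖ ^ 2 ≤ ∑ _i : Fin d, b ^ 2 := Finset.sum_le_sum fun i _ =>
        pow_le_pow_left₀ (norm_nonneg _) (h i) 2
    _ = d * b ^ 2 := by simp
    _ ≤ (d * b) ^ 2 := by
      have hd : (d : ℝ) ≤ (d : ℝ) ^ 2 := by exact_mod_cast Nat.le_self_pow two_ne_zero d
      nlinarith [mul_le_mul_of_nonneg_right hd (sq_nonneg b)]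

theorem lt_norm_of_not_forall_abs_le {d : ℕ} {y : EuclideanSpace ℝ (Fin d)} {b : ℝ}
    (h : ¬ ∀ i, |y i| ≤ b) : b < ‖y‖ := by
  push Not at h
  obtain ⟨i, hi⟩ := h
  exact hi.trans_le (PiLp.norm_apply_le y i)

/-- The lattice points with spacing `1 / r` and coordinates at most `m / r`. -/
noncomputable def gridPoint (m : ℕ) (r : ℝ) {d : ℕ} (k : Fin d → Fin (2 * m + 1)) :
    EuclideanSpace ℝ (Fin d) :=
  WithLp.toLp 2 fun i => latticePoint m k i / r

theorem norm_sub_gridPoint_le {m d : ℕ} {r : ℝ} (hr : 0 < r) {k : Fin d → Fin (2 * m + 1)}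
    {y : EuclideanSpace ℝ (Fin d)} (h : ∀ i, |r * y i - latticePoint m k i| ≤ 1) :
    ‖y - gridPoint m r k‖ ≤ d / r := by
  rw [div_eq_mul_inv]
  refine norm_le_of_abs_le (by positivity) fun i => ?_
  have e : (y - gridPoint m r k) i = (r * y i - latticePoint m k i) / r := by
    simp only [gridPoint, PiLp.sub_apply]
    field_simp
  rw [e, abs_div, abs_of_pos hr, div_eq_mul_inv]
  exact mul_le_of_le_one_left (by positivity) (h i)

theorem norm_gridPoint_le {m d : ℕ} {r : ℝ} (hr : 0 < r) (k : Fin d → Fin (2 * m + 1)) :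
    ‖gridPoint m r k‖ ≤ d * (m / r) := by
  refine norm_le_of_abs_le (by positivity) fun i => ?_
  simp only [gridPoint, abs_div, abs_of_pos hr]
  gcongr
  exact abs_latticePoint_le m k i

theorem abs_le_add_of_lipschitz {d : ℕ} {v : EuclideanSpace ℝ (Fin d) → ℝ} {L V : ℝ}
    (h0 : |v 0| ≤ V) (hv : ∀ y z, |v y - v z| ≤ L * ‖y - z‖) (y : EuclideanSpace ℝ (Fin d)) :
    |v y| ≤ V + L * ‖y‖ := by
  have h := hv y 0
  rw [sub_zero] at h
  linarith [abs_sub_abs_le_abs_sub (v y) (v 0)]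

/-- Error of the interpolation of a Lipschitz function in the nodes of a lattice. -/
theorem abs_sub_sum_hat_le {d : ℕ} {v : EuclideanSpace ℝ (Fin d) → ℝ} {L V : ℝ} (hL : 0 ≤ L)
    (h0 : |v 0| ≤ V) (hv : ∀ y z, |v y - v z| ≤ L * ‖y - z‖) {N : ℕ} (hN : 1 ≤ N)
    (y : EuclideanSpace ℝ (Fin d)) :
    |v y - ∑ k : Fin d → Fin (2 * N ^ 2 + 1), v (gridPoint (N ^ 2) N k) *
        hat (fun i => N * y i - latticePoint (N ^ 2) k i)| ≤
      (2 * V + 2 * L + L * d) * (1 + ‖y‖ ^ 2) / N := by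
  have hN1 : (1 : ℝ) ≤ N := by exact_mod_cast hN
  have hN0 : (0 : ℝ) < N := by linarith
  have hV : 0 ≤ V := (abs_nonneg _).trans h0
  have hd : (d : ℝ) / N ≤ d := div_le_self (Nat.cast_nonneg d) hN1
  have hgrid : ∀ k : Fin d → Fin (2 * N ^ 2 + 1),
      0 < hat (fun i => N * y i - latticePoint (N ^ 2) k i) →
      ‖y - gridPoint (N ^ 2) N k‖ ≤ d / N := fun k hk =>
    norm_sub_gridPoint_le hN0 fun i => (abs_lt_one_of_hat_pos hk i).le
  -- Only nodes within `d / N` of `y` carry weight, and the weights sum to at most `1`, even outside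
  -- the box.
  have hsum : ∀ (F : (Fin d → Fin (2 * N ^ 2 + 1)) → ℝ) (b : ℝ), 0 ≤ b →
      (∀ k, ‖y - gridPoint (N ^ 2) N k‖ ≤ d / N → |F k| ≤ b) →
      |∑ k, F k * hat (fun i => N * y i - latticePoint (N ^ 2) k i)| ≤ b := by
    intro F b hb hF
    calc _ ≤ ∑ k, |F k * hat (fun i => N * y i - latticePoint (N ^ 2) k i)| :=
          Finset.abs_sum_le_sum_abs _ _
      _ ≤ ∑ k, b * hat (fun i => N * y i - latticePoint (N ^ 2) k i) := by
          refine Finset.sum_le_sum fun k _ => ?_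
          rw [abs_mul, abs_of_nonneg (hat_nonneg _)]
          rcases (hat_nonneg fun i => N * y i - latticePoint (N ^ 2) k i).eq_or_lt with h | h
          · rw [← h, mul_zero, mul_zero]
          · exact mul_le_mul_of_nonneg_right (hF k (hgrid k h)) h.le
      _ ≤ b := by
          rw [← Finset.mul_sum]
          exact mul_le_of_le_one_right hb (sum_hat_le_one (N ^ 2) fun i => N * y i)
  by_cases hy : ∀ i, |y i| ≤ N
  · have h1 : ∑ k : Fin d → Fin (2 * N ^ 2 + 1),
        hat (fun i => N * y i - latticePoint (N ^ 2) k i) = 1 :=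
      sum_hat_eq_one (N ^ 2) (fun i => N * y i) fun i => by
        rw [abs_mul, abs_of_pos hN0, Nat.cast_pow, sq]
        exact mul_le_mul_of_nonneg_left (hy i) hN0.le
    have e : v y - ∑ k : Fin d → Fin (2 * N ^ 2 + 1), v (gridPoint (N ^ 2) N k) *
        hat (fun i => N * y i - latticePoint (N ^ 2) k i) =
        ∑ k : Fin d → Fin (2 * N ^ 2 + 1), (v y - v (gridPoint (N ^ 2) N k)) *
        hat (fun i => N * y i - latticePoint (N ^ 2) k i) := by
      simp only [sub_mul, Finset.sum_sub_distrib]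
      rw [← Finset.mul_sum, h1, mul_one]
    rw [e]
    refine (hsum _ (L * (d / N)) (by positivity) fun k hk =>
      (hv _ _).trans (mul_le_mul_of_nonneg_left hk hL)).trans ?_
    rw [← mul_div_assoc]
    refine div_le_div_of_nonneg_right ?_ hN0.le
    nlinarith [sq_nonneg ‖y‖, mul_nonneg hL (Nat.cast_nonneg (α := ℝ) d),
      mul_nonneg (show 0 ≤ 2 * V + 2 * L + L * d by positivity) (sq_nonneg ‖y‖)]
  -- Outside the box `‖y‖ > N`, so a crude linear bound is at most a multiple of `‖y‖ ^ 2 / N`.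
  · have hyN := lt_norm_of_not_forall_abs_le hy
    have h1 := abs_le_add_of_lipschitz h0 hv y
    have h2 := hsum (fun k => v (gridPoint (N ^ 2) N k)) (V + L * (‖y‖ + d)) (by positivity)
      fun k hk => (abs_le_add_of_lipschitz h0 hv _).trans <| by
        have := norm_sub_norm_le (gridPoint (N ^ 2) N k) y
        rw [norm_sub_rev] at this
        gcongr
        linarith
    have h3 : ‖y‖ ≤ ‖y‖ ^ 2 / N := by
      rw [le_div_iff₀ hN0, sq]
      gcongr
    have h4 : 1 ≤ ‖y‖ := by linarith
    calc _ ≤ |v y| + |∑ k : Fin d → Fin (2 * N ^ 2 + 1), v (gridPoint (N ^ 2) N k) *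
        hat (fun i => N * y i - latticePoint (N ^ 2) k i)| := abs_sub _ _
      _ ≤ (V + L * ‖y‖) + (V + L * (‖y‖ + d)) := add_le_add h1 h2
      _ ≤ (2 * V + 2 * L + L * d) * ‖y‖ := by
          nlinarith [mul_nonneg hL (Nat.cast_nonneg (α := ℝ) d),
            mul_nonneg (show 0 ≤ 2 * V + L * d by positivity) (sub_nonneg.2 h4)]
      _ ≤ (2 * V + 2 * L + L * d) * (‖y‖ ^ 2 / N) := by gcongr
      _ ≤ _ := by
          rw [mul_div_assoc]
          gcongr
          linarith

/-- Lipschitz functions that are close in the sample points are close, up to polynomial growth. -/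
theorem abs_sub_le_of_samples {d : ℕ} {g h : EuclideanSpace ℝ (Fin d) → ℝ} {L V : ℝ} (hL : 0 ≤ L)
    (hV : 0 ≤ V) (hg0 : |g 0| ≤ V) (hh0 : |h 0| ≤ V) (hg : ∀ y z, |g y - g z| ≤ L * ‖y - z‖)
    (hh : ∀ y z, |h y - h z| ≤ L * ‖y - z‖) {N : ℕ} (hN : 1 ≤ N)
    (hs : ∀ k : Fin d → Fin (2 * N ^ 3 + 1), |g (gridPoint (N ^ 3) ((N : ℝ) ^ 2) k) -
      h (gridPoint (N ^ 3) ((N : ℝ) ^ 2) k)| ≤ 2 / (N : ℝ) ^ 2)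
    (y : EuclideanSpace ℝ (Fin d)) :
    |g y - h y| ≤ (2 + 2 * V + 2 * L + 2 * L * d) / (N : ℝ) ^ 2 * (1 + ‖y‖ ^ 3) := by
  have hN1 : (1 : ℝ) ≤ N := by exact_mod_cast hN
  have hN0 : (0 : ℝ) < N := by linarith
  rw [div_mul_eq_mul_div]
  by_cases hy : ∀ i, |y i| ≤ N
  · have h1 : ∀ i, ∃ j : Fin (2 * N ^ 3 + 1), ((j : ℕ) : ℤ) - (N ^ 3 : ℕ) = ⌊(N : ℝ) ^ 2 * y i⌋ := by
      intro i
      have h2 : |(N : ℝ) ^ 2 * y i| ≤ (N ^ 3 : ℕ) := by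
        rw [abs_mul, abs_of_pos (by positivity)]
        push_cast
        calc (N : ℝ) ^ 2 * |y i| ≤ (N : ℝ) ^ 2 * N := by gcongr; exact hy i
          _ = (N : ℝ) ^ 3 := by ring
      have h3 := abs_le.1 h2
      refine exists_coe_sub_eq _ (Int.le_floor.2 ?_) (Int.le_of_lt_add_one (Int.floor_lt.2 ?_))
      · push_cast at h3 ⊢; linarith
      · push_cast at h3 ⊢; linarith
    choose k hk using h1
    have h2 : ‖y - gridPoint (N ^ 3) ((N : ℝ) ^ 2) k‖ ≤ d / (N : ℝ) ^ 2 := by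
      refine norm_sub_gridPoint_le (by positivity) fun i => ?_
      have h3 : latticePoint (N ^ 3) k i = (⌊(N : ℝ) ^ 2 * y i⌋ : ℝ) := by
        rw [← hk i, latticePoint]; push_cast; rfl
      rw [h3, abs_of_nonneg (sub_nonneg.2 (Int.floor_le _))]
      linarith [Int.lt_floor_add_one ((N : ℝ) ^ 2 * y i)]
    set z := gridPoint (N ^ 3) ((N : ℝ) ^ 2) k
    have h3 := (hg y z).trans (mul_le_mul_of_nonneg_left h2 hL)
    have h4 := (hh y z).trans (mul_le_mul_of_nonneg_left h2 hL)
    have h5 := hs k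
    calc |g y - h y| ≤ |g y - g z| + |g z - h z| + |h y - h z| := by
          have := abs_sub_le (g y) (g z) (h y)
          have := abs_sub_le (g z) (h z) (h y)
          rw [abs_sub_comm (h y) (h z)]
          linarith
      _ ≤ L * (d / (N : ℝ) ^ 2) + 2 / (N : ℝ) ^ 2 + L * (d / (N : ℝ) ^ 2) := by gcongr
      _ = (2 + 2 * L * d) / (N : ℝ) ^ 2 := by ring
      _ ≤ _ := by
        gcongr
        have h6 : 0 ≤ (2 + 2 * V + 2 * L + 2 * L * d) * ‖y‖ ^ 3 := by positivity
        nlinarith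
  · have hyN := lt_norm_of_not_forall_abs_le hy
    have h1 := abs_le_add_of_lipschitz hg0 hg y
    have h2 := abs_le_add_of_lipschitz hh0 hh y
    have h3 : 1 ≤ ‖y‖ := by linarith
    rw [le_div_iff₀ (by positivity)]
    calc |g y - h y| * (N : ℝ) ^ 2 ≤ ((2 * V + 2 * L) * ‖y‖) * ‖y‖ ^ 2 := by
          gcongr
          have := abs_sub (g y) (h y)
          nlinarith
      _ = (2 * V + 2 * L) * ‖y‖ ^ 3 := by ring
      _ ≤ _ := by
          have h6 : 0 ≤ (2 + 2 * L * d) * ‖y‖ ^ 3 := by positivity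
          have h7 : 0 ≤ 2 + 2 * V + 2 * L + 2 * L * d := by positivity
          nlinarith

/-- Representatives of the lattice cells in the space of sample vectors. -/
theorem exists_representatives {E : Type*} {𝒢 : Set (E → ℝ)} (h𝒢 : 𝒢.Nonempty) {n m : ℕ}
    (s : Fin n → E) {r : ℝ} (hr : 0 < r) :
    ∃ rep : (Fin n → Fin (2 * m + 1)) → 𝒢, ∀ (g : 𝒢) (k : Fin n → Fin (2 * m + 1)),
      0 < hat (fun i => r * (g : E → ℝ) (s i) - latticePoint m k i) →
      ∀ i, |(g : E → ℝ) (s i) - (rep k : E → ℝ) (s i)| ≤ 2 / r := by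
  classical
  have hex : ∀ k : Fin n → Fin (2 * m + 1), ∃ h : 𝒢, ∀ g : 𝒢,
      0 < hat (fun i => r * (g : E → ℝ) (s i) - latticePoint m k i) →
      ∀ i, |(g : E → ℝ) (s i) - (h : E → ℝ) (s i)| ≤ 2 / r := by
    intro k
    -- Two members in the support of one hat are each within `1 / r` of its node in every sample.
    -- For a cell that no member meets, any choice works.
    by_cases hk : ∃ h : 𝒢, 0 < hat (fun i => r * (h : E → ℝ) (s i) - latticePoint m k i)
    · obtain ⟨h, hh⟩ := hk
      refine ⟨h, fun g hg i => ?_⟩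
      have h1 := abs_lt.1 (abs_lt_one_of_hat_pos hh i)
      have h2 := abs_lt.1 (abs_lt_one_of_hat_pos hg i)
      have e : ∀ t : ℝ, |t| * r = |t * r| := fun t => by rw [abs_mul, abs_of_pos hr]
      rw [le_div_iff₀ hr, e, abs_le]
      constructor <;> nlinarith [h1.1, h1.2, h2.1, h2.2]
    · exact ⟨⟨_, h𝒢.some_mem⟩, fun g hg => absurd ⟨g, hg⟩ hk⟩
  choose rep hrep using hex
  exact ⟨rep, fun g k => hrep k g⟩

/-! ### The operator network -/

section Operator

variable {Ω : Type*} [mΩ : MeasurableSpace Ω] {P : Measure Ω} {T : ℝ}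

theorem expectSup_one_le_of_holder [IsProbabilityMeasure P] {d₁ d₂ : ℕ}
    {X : Icc (0 : ℝ) T → Ω → EuclideanSpace ℝ (Fin d₁)}
    {X' : Icc (0 : ℝ) T → Ω → EuclideanSpace ℝ (Fin d₂)} {f : EuclideanSpace ℝ (Fin d₁) → ℝ}
    {w : EuclideanSpace ℝ (Fin d₂) → ℝ} {a m l N : ℝ} (ha : 0 ≤ a) (hl : 0 ≤ l) (hN : 1 ≤ N)
    (hm : expect P (fun ω => ⨆ t, ENNReal.ofReal ‖X t ω‖ ^ (6 : ℝ)) ≤ ENNReal.ofReal m)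
    (hf : ∀ y, |f y| ≤ a / N ^ 2 * (1 + ‖y‖ ^ 3))
    (hw : normS2 P X' w ^ 2 ≤ ENNReal.ofReal (l ^ 2) * (normS2 P X f + normS2 P X f ^ 2)) :
    expectSup P X' 1 w ≤ ENNReal.ofReal (l * (1 + 2 * a * (1 + |m|)) / N) := by
  have h := normS2_le_of_cubic_growth (by positivity) hf hm
  have e : 2 * (a / N ^ 2) * (1 + |m|) = 2 * a * (1 + |m|) / N ^ 2 := by ring
  rw [e] at h
  exact expectSup_one_le_normS2.trans (le_of_sq_le_add_sq hl (by positivity) hN hw h)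

/-- Along any path `|w 0| ≤ |w (X 0)| + L ‖X 0‖`; the left side is deterministic, so it survives
taking expectations. -/
theorem abs_zero_le_of_expectSup_le [IsProbabilityMeasure P] {d : ℕ}
    {X : Icc (0 : ℝ) T → Ω → EuclideanSpace ℝ (Fin d)}
    (hT : 0 ≤ T) {w : EuclideanSpace ℝ (Fin d) → ℝ} {L b m : ℝ} (hL : 0 ≤ L) (hb : 0 ≤ b)
    (hw : ∀ y z, |w y - w z| ≤ L * ‖y - z‖) (hwb : expectSup P X 1 w ≤ ENNReal.ofReal b)
    (hm : expect P (fun ω => ⨆ t, ENNReal.ofReal ‖X t ω‖ ^ (1 : ℝ)) ≤ ENNReal.ofReal m) :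
    |w 0| ≤ b + L * |m| := by
  rw [← ENNReal.ofReal_le_ofReal_iff (by positivity)]
  let t₀ : Icc (0 : ℝ) T := ⟨0, le_rfl, hT⟩
  calc ENNReal.ofReal |w 0| ≤ expect P fun ω => (⨆ t, ENNReal.ofReal |w (X t ω)| ^ (1 : ℝ)) +
        ENNReal.ofReal L * ⨆ t, ENNReal.ofReal ‖X t ω‖ ^ (1 : ℝ) := by
        refine le_expect fun ω => ?_
        have h1 : |w 0| ≤ |w (X t₀ ω)| + L * ‖X t₀ ω‖ := by
          have h := hw 0 (X t₀ ω)
          rw [zero_sub, norm_neg] at h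
          linarith [abs_sub_abs_le_abs_sub (w 0) (w (X t₀ ω))]
        calc ENNReal.ofReal |w 0| ≤ ENNReal.ofReal |w (X t₀ ω)| ^ (1 : ℝ) +
              ENNReal.ofReal L * ENNReal.ofReal ‖X t₀ ω‖ ^ (1 : ℝ) := by
              rw [ENNReal.rpow_one, ENNReal.rpow_one, ← ENNReal.ofReal_mul hL,
                ← ENNReal.ofReal_add (abs_nonneg _) (by positivity)]
              exact ENNReal.ofReal_le_ofReal h1
          _ ≤ _ := by
              gcongr
              · exact le_iSup (fun t => ENNReal.ofReal |w (X t ω)| ^ (1 : ℝ)) t₀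
              · exact le_iSup (fun t => ENNReal.ofReal ‖X t ω‖ ^ (1 : ℝ)) t₀
    _ ≤ ENNReal.ofReal b + ENNReal.ofReal L * ENNReal.ofReal m := by
        refine (expect_add_le _ _).trans (add_le_add hwb ?_)
        refine (expect_const_mul_le _ _ ENNReal.ofReal_ne_top).trans ?_
        gcongr
    _ ≤ ENNReal.ofReal b + ENNReal.ofReal L * ENNReal.ofReal |m| := by
        gcongr
        exact le_abs_self m
    _ = ENNReal.ofReal (b + L * |m|) := by
        rw [ENNReal.ofReal_add hb (by positivity), ENNReal.ofReal_mul hL]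

/-- Closeness is asked only at positive weights, because a representative is near `g` only when the
hat of its cell is positive at the samples of `g`. -/
theorem expectSup_one_sum_le {d : ℕ} {X : Icc (0 : ℝ) T → Ω → EuclideanSpace ℝ (Fin d)}
    {ι : Type*} [Fintype ι] {φ : ι → ℝ} (hφ : ∀ n, 0 ≤ φ n) (hφ1 : ∑ n, φ n = 1)
    {f : ι → EuclideanSpace ℝ (Fin d) → ℝ} {η : ℝ}
    (hf : ∀ n, 0 < φ n → expectSup P X 1 (f n) ≤ ENNReal.ofReal η) :
    expectSup P X 1 (fun y => ∑ n, φ n * |f n y|) ≤ ENNReal.ofReal η := by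
  calc expectSup P X 1 (fun y => ∑ n, φ n * |f n y|)
      ≤ expect P fun ω => ∑ n, ENNReal.ofReal (φ n) *
          ⨆ t, ENNReal.ofReal |f n (X t ω)| ^ (1 : ℝ) := by
        refine expect_mono fun ω => iSup_le fun t => ?_
        have h0 : ∀ n ∈ Finset.univ, 0 ≤ φ n * |f n (X t ω)| := fun n _ =>
          mul_nonneg (hφ n) (abs_nonneg _)
        rw [abs_of_nonneg (Finset.sum_nonneg h0), ENNReal.rpow_one, ENNReal.ofReal_sum_of_nonneg h0]
        refine Finset.sum_le_sum fun n _ => ?_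
        rw [ENNReal.ofReal_mul (hφ n)]
        gcongr
        exact le_iSup_of_le t (by rw [ENNReal.rpow_one])
    _ ≤ ∑ n, ENNReal.ofReal (φ n) * ENNReal.ofReal η := by
        refine (expect_sum_le _ _).trans (Finset.sum_le_sum fun n _ => ?_)
        refine (expect_const_mul_le _ _ ENNReal.ofReal_ne_top).trans ?_
        rcases (hφ n).eq_or_lt with h | h
        · simp [← h]
        · gcongr
          exact hf n h
    _ = ENNReal.ofReal η := by
        rw [← Finset.sum_mul, ← ENNReal.ofReal_sum_of_nonneg fun n _ => hφ n, hφ1,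
          ENNReal.ofReal_one, one_mul]

/-- Replacing a function by a convex combination of approximations of nearby functions. -/
theorem expectSup_one_sub_le [IsProbabilityMeasure P] {d : ℕ}
    {X : Icc (0 : ℝ) T → Ω → EuclideanSpace ℝ (Fin d)}
    {ι : Type*} [Fintype ι] {φ : ι → ℝ} (hφ : ∀ n, 0 ≤ φ n) (hφ1 : ∑ n, φ n = 1)
    {u : EuclideanSpace ℝ (Fin d) → ℝ} {w v : ι → EuclideanSpace ℝ (Fin d) → ℝ} {η b m : ℝ}
    (hη : 0 ≤ η) (hb : 0 ≤ b)
    (hw : ∀ n, 0 < φ n → expectSup P X 1 (fun y => u y - w n y) ≤ ENNReal.ofReal η)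
    (hv : ∀ n y, |w n y - v n y| ≤ b * (1 + ‖y‖ ^ 2))
    (hm : expect P (fun ω => ⨆ t, ENNReal.ofReal ‖X t ω‖ ^ (2 : ℝ)) ≤ ENNReal.ofReal m) :
    expectSup P X 1 (fun y => u y - ∑ n, φ n * v n y) ≤ ENNReal.ofReal (η + b * (1 + |m|)) := by
  have hpt : ∀ y, |u y - ∑ n, φ n * v n y| ≤
      |(∑ n, φ n * |u y - w n y| : ℝ)| + |b * (1 + ‖y‖ ^ 2)| := by
    intro y
    rw [abs_of_nonneg (a := b * (1 + ‖y‖ ^ 2)) (by positivity),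
      abs_of_nonneg (a := ∑ n, _) (Finset.sum_nonneg fun n _ => mul_nonneg (hφ n) (abs_nonneg _))]
    calc |u y - ∑ n, φ n * v n y| = |∑ n, φ n * (u y - v n y)| := by
          simp only [mul_sub, Finset.sum_sub_distrib]
          rw [← Finset.sum_mul, hφ1, one_mul]
      _ ≤ ∑ n, |φ n * (u y - v n y)| := Finset.abs_sum_le_sum_abs _ _
      _ ≤ ∑ n, (φ n * |u y - w n y| + φ n * (b * (1 + ‖y‖ ^ 2))) := by
          refine Finset.sum_le_sum fun n _ => ?_
          rw [abs_mul, abs_of_nonneg (hφ n), ← mul_add]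
          refine mul_le_mul_of_nonneg_left ?_ (hφ n)
          have := abs_sub_le (u y) (w n y) (v n y)
          linarith [hv n y]
      _ = _ := by rw [Finset.sum_add_distrib, ← Finset.sum_mul, hφ1, one_mul]
  have h1 : expectSup P X 1 (fun y => ∑ n, φ n * |u y - w n y|) ≤ ENNReal.ofReal η :=
    expectSup_one_sum_le (f := fun n y => u y - w n y) hφ hφ1 hw
  have h2 : expectSup P X 1 (fun y => b * (1 + ‖y‖ ^ 2)) ≤ ENNReal.ofReal (b * (1 + |m|)) := by
    refine expectSup_le_of_growth zero_le_one zero_le_two hb (fun y => ?_) hm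
    rw [Real.rpow_one, Real.rpow_two, abs_of_nonneg (by positivity)]
  calc _ ≤ expect P fun ω =>
        (⨆ t, ENNReal.ofReal |(∑ n, φ n * |u (X t ω) - w n (X t ω)| : ℝ)| ^ (1 : ℝ)) +
        ⨆ t, ENNReal.ofReal |b * (1 + ‖X t ω‖ ^ 2)| ^ (1 : ℝ) := by
        refine expect_mono fun ω => iSup_le fun t => ?_
        refine le_trans ?_ (add_le_add (le_iSup _ t) (le_iSup _ t))
        simp only [ENNReal.rpow_one]
        rw [← ENNReal.ofReal_add (abs_nonneg _) (abs_nonneg _)]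
        exact ENNReal.ofReal_le_ofReal (hpt _)
    _ ≤ ENNReal.ofReal η + ENNReal.ofReal (b * (1 + |m|)) :=
        (expect_add_le _ _).trans (add_le_add h1 h2)
    _ = _ := (ENNReal.ofReal_add hη (by positivity)).symm

/-- The constant in the error bound for the operator network. -/
noncomputable def operatorErrorConst (d₁ d₂ : ℕ) (M : ℝ → ℝ) (Cg Lg Lu LΓ : ℝ) : ℝ :=
  let η := LΓ * (1 + 2 * (2 + 2 * Cg + 2 * Lg + 2 * Lg * d₁) * (1 + |M 6|))
  η + (2 * (η + 2 * Lu * |M 1|) + 2 * Lu + Lu * d₂) * (1 + |M 2|)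

theorem operatorErrorConst_nonneg (d₁ d₂ : ℕ) (M : ℝ → ℝ) {Cg Lg Lu LΓ : ℝ} (hCg : 0 ≤ Cg)
    (hLg : 0 ≤ Lg) (hLu : 0 ≤ Lu) (hLΓ : 0 ≤ LΓ) :
    0 ≤ operatorErrorConst d₁ d₂ M Cg Lg Lu LΓ := by
  unfold operatorErrorConst
  positivity

/-- The condition `hN2` keeps all samples in `[-N², N²]`, the range covered by the branch lattice.
In `e₁`, the value `none` indexes the constant trunk function. -/
theorem exists_operator_network [IsProbabilityMeasure P] {d₁ d₂ : ℕ} (hT : 0 ≤ T) {M : ℝ → ℝ} {Cg Lg Lu LΓ : ℝ}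
    (hCg : 0 ≤ Cg) (hLg : 0 ≤ Lg) (hLu : 0 ≤ Lu) (hLΓ : 0 ≤ LΓ)
    {X : Icc (0 : ℝ) T → Ω → EuclideanSpace ℝ (Fin d₁)}
    {X' : Icc (0 : ℝ) T → Ω → EuclideanSpace ℝ (Fin d₂)}
    (hX : expect P (fun ω => ⨆ t, ENNReal.ofReal ‖X t ω‖ ^ (6 : ℝ)) ≤ ENNReal.ofReal (M 6))
    (hX1 : expect P (fun ω => ⨆ t, ENNReal.ofReal ‖X' t ω‖ ^ (1 : ℝ)) ≤ ENNReal.ofReal (M 1))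
    (hX2 : expect P (fun ω => ⨆ t, ENNReal.ofReal ‖X' t ω‖ ^ (2 : ℝ)) ≤ ENNReal.ofReal (M 2))
    {𝒢 : Set (EuclideanSpace ℝ (Fin d₁) → ℝ)} (h0 : ∀ g ∈ 𝒢, |g 0| ≤ Cg)
    (hLip : ∀ g ∈ 𝒢, ∀ y z, |g y - g z| ≤ Lg * ‖y - z‖)
    {N : ℕ} (hN : 1 ≤ N) (hN2 : Cg + Lg * (d₁ * N) ≤ (N : ℝ) ^ 2)
    {N₁ Nδ H : ℕ} (e₁ : Option (Fin d₂ → Fin (2 * N ^ 2 + 1)) ≃ Fin N₁)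
    (eδ : (Fin d₁ → Fin (2 * N ^ 3 + 1)) ≃ Fin Nδ)
    (eH : (Fin Nδ → Fin (2 * N ^ 4 + 1)) ≃ Fin H)
    (Γ : 𝒢 → EuclideanSpace ℝ (Fin d₂) → ℝ) (hΓ : ∀ g y z, |Γ g y - Γ g z| ≤ Lu * ‖y - z‖)
    (hΓ2 : ∀ g₁ g₂ : 𝒢, normS2 P X' (fun y => Γ g₁ y - Γ g₂ y) ^ 2 ≤
      ENNReal.ofReal (LΓ ^ 2) *
        (normS2 P X (fun y => (g₁ : EuclideanSpace ℝ (Fin d₁) → ℝ) y -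
            (g₂ : EuclideanSpace ℝ (Fin d₁) → ℝ) y) +
          normS2 P X (fun y => (g₁ : EuclideanSpace ℝ (Fin d₁) → ℝ) y -
            (g₂ : EuclideanSpace ℝ (Fin d₁) → ℝ) y) ^ 2)) :
    ∃ (q : Fin N₁ → (Fin d₂ → ℝ) → (Fin 1 → ℝ))
      (a : Fin N₁ → Fin H → ℝ) (b : Fin N₁ → Fin H → (Fin Nδ → ℝ) → (Fin 1 → ℝ)),
      (∀ k, q k ∈ FNN d₂ 1 (d₂ + 3) (2 * d₂ + 1) (4 * (2 * d₂ + 1) * (d₂ + 1) + 6)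
        ((N : ℝ) ^ 2) 1) ∧
      (∀ k n, b k n ∈ FNN Nδ 1 (Nδ + 3) (2 * Nδ + 1) (4 * (2 * Nδ + 1) * (Nδ + 1) + 6)
        ((N : ℝ) ^ 4) 1) ∧
      ⨆ g : 𝒢, expectSup P X' 1 (fun y => Γ g y - ∑ k, (∑ n, a k n *
        b k n (fun m => (g : EuclideanSpace ℝ (Fin d₁) → ℝ)
          (gridPoint (N ^ 3) ((N : ℝ) ^ 2) (eδ.symm m))) 0) * q k y.ofLp 0) ≤
        ENNReal.ofReal (operatorErrorConst d₁ d₂ M Cg Lg Lu LΓ / N) := by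
  have hN1 : (1 : ℝ) ≤ N := by exact_mod_cast hN
  have hN0 : (0 : ℝ) < N := by linarith
  let s : Fin Nδ → EuclideanSpace ℝ (Fin d₁) := fun m =>
    gridPoint (N ^ 3) ((N : ℝ) ^ 2) (eδ.symm m)
  -- With zero scale and shift the hat network outputs the constant `1`, so the constant trunk
  -- function has the same architecture as the others.
  let q : Fin N₁ → (Fin d₂ → ℝ) → (Fin 1 → ℝ) := fun j x _ =>
    match e₁.symm j with
    | none => hat fun i => 0 * x i - 0
    | some k => hat fun i => N * x i - latticePoint (N ^ 2) k i
  let b : Fin N₁ → Fin H → (Fin Nδ → ℝ) → (Fin 1 → ℝ) := fun _ n x _ =>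
    hat fun i => (N : ℝ) ^ 2 * x i - latticePoint (N ^ 4) (eH.symm n) i
  have hq : ∀ k, q k ∈ FNN d₂ 1 (d₂ + 3) (2 * d₂ + 1) (4 * (2 * d₂ + 1) * (d₂ + 1) + 6)
      ((N : ℝ) ^ 2) 1 := by
    intro j
    simp only [q]
    rcases e₁.symm j with _ | k
    · exact hat_mem_FNN d₂ (k := fun _ => 0) (one_le_pow₀ hN1) (by simp) (by simp)
    · refine hat_mem_FNN d₂ (one_le_pow₀ hN1) ?_ fun i => ?_
      · rw [abs_of_pos hN0]
        exact le_self_pow₀ hN1 two_ne_zero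
      · exact_mod_cast abs_latticePoint_le (N ^ 2) k i
  have hb : ∀ k n, b k n ∈ FNN Nδ 1 (Nδ + 3) (2 * Nδ + 1) (4 * (2 * Nδ + 1) * (Nδ + 1) + 6)
      ((N : ℝ) ^ 4) 1 := by
    intro k n
    refine hat_mem_FNN Nδ (one_le_pow₀ hN1) ?_ fun i => ?_
    · rw [abs_of_pos (by positivity)]
      exact pow_le_pow_right₀ hN1 (by norm_num)
    · exact_mod_cast abs_latticePoint_le (N ^ 4) (eH.symm n) i
  rcases 𝒢.eq_empty_or_nonempty with h𝒢 | h𝒢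
  · have : IsEmpty 𝒢 := by rw [h𝒢]; infer_instance
    exact ⟨q, fun _ _ => 0, b, hq, hb, by rw [iSup_of_empty]; exact bot_le⟩
  let g₀ : 𝒢 := ⟨_, h𝒢.some_mem⟩
  obtain ⟨rep, hrep⟩ := exists_representatives (m := N ^ 4) h𝒢 s (r := (N : ℝ) ^ 2) (by positivity)
  set K : ℝ := 2 + 2 * Cg + 2 * Lg + 2 * Lg * d₁ with hK
  have hK0 : 0 ≤ K := by positivity
  set η : ℝ := LΓ * (1 + 2 * K * (1 + |M 6|)) with hη
  have hη0 : 0 ≤ η := by positivity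
  -- all outputs of the operator are close to each other at the origin
  have hV : ∀ g, |Γ g 0 - Γ g₀ 0| ≤ η + 2 * Lu * |M 1| := by
    intro g
    refine abs_zero_le_of_expectSup_le (w := fun y => Γ g y - Γ g₀ y) hT (by positivity) hη0
      (fun y z => ?_) ?_ hX1
    · have h1 := hΓ g y z
      have h2 := hΓ g₀ y z
      have h3 := abs_sub (Γ g y - Γ g z) (Γ g₀ y - Γ g₀ z)
      have e : Γ g y - Γ g₀ y - (Γ g z - Γ g₀ z) = Γ g y - Γ g z - (Γ g₀ y - Γ g₀ z) := by ring
      rw [e]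
      linarith
    -- The Hölder estimate at resolution `1`: any two inputs differ by at most `K * (1 + ‖y‖ ^ 3)`
    -- by growth alone.
    · have h := expectSup_one_le_of_holder hK0 hLΓ le_rfl hX (fun y => ?_) (hΓ2 g g₀)
      · rwa [div_one] at h
      · have h1 := abs_le_add_of_lipschitz (h0 g g.2) (hLip g g.2) y
        have h2 := abs_le_add_of_lipschitz (h0 g₀ g₀.2) (hLip g₀ g₀.2) y
        have h3 := abs_sub ((g : EuclideanSpace ℝ (Fin d₁) → ℝ) y)
          ((g₀ : EuclideanSpace ℝ (Fin d₁) → ℝ) y)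
        have h4 : ‖y‖ ≤ 1 + ‖y‖ ^ 3 := by
          rcases le_total ‖y‖ 1 with h | h
          · linarith [pow_nonneg (norm_nonneg y) 3]
          · linarith [le_self_pow₀ h three_ne_zero]
        have h5 := mul_le_mul_of_nonneg_left h4 hLg
        have h6 : 0 ≤ 2 + 2 * Lg * d₁ := by positivity
        have h7 : 0 ≤ ‖y‖ ^ 3 := by positivity
        rw [one_pow, div_one, hK]
        nlinarith [mul_nonneg h6 h7, mul_nonneg hCg h7]
  let v : (Fin Nδ → Fin (2 * N ^ 4 + 1)) → EuclideanSpace ℝ (Fin d₂) → ℝ := fun n y =>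
    Γ (rep n) y - Γ g₀ 0
  let a : Fin N₁ → Fin H → ℝ := fun j n =>
    match e₁.symm j with
    | none => Γ g₀ 0
    | some k => v (eH.symm n) (gridPoint (N ^ 2) N k)
  refine ⟨q, a, b, hq, hb, iSup_le fun g => ?_⟩
  let φ : (Fin Nδ → Fin (2 * N ^ 4 + 1)) → ℝ := fun n =>
    hat fun i => (N : ℝ) ^ 2 * (g : EuclideanSpace ℝ (Fin d₁) → ℝ) (s i) - latticePoint (N ^ 4) n i
  have hφ1 : ∑ n, φ n = 1 := by
    refine sum_hat_eq_one (N ^ 4)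
      (fun i => (N : ℝ) ^ 2 * (g : EuclideanSpace ℝ (Fin d₁) → ℝ) (s i)) fun i => ?_
    have h1 := abs_le_add_of_lipschitz (h0 g g.2) (hLip g g.2) (s i)
    have h2 : ‖s i‖ ≤ d₁ * N := by
      refine (norm_gridPoint_le (by positivity) _).trans_eq ?_
      push_cast
      field_simp
    have h3 := mul_le_mul_of_nonneg_left h2 hLg
    rw [abs_mul, abs_of_pos (by positivity), Nat.cast_pow,
      show (N : ℝ) ^ 4 = (N : ℝ) ^ 2 * (N : ℝ) ^ 2 by ring]
    gcongr
    linarith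
  let I : (Fin Nδ → Fin (2 * N ^ 4 + 1)) → EuclideanSpace ℝ (Fin d₂) → ℝ := fun n y =>
    Γ g₀ 0 + ∑ k : Fin d₂ → Fin (2 * N ^ 2 + 1), v n (gridPoint (N ^ 2) N k) *
      hat (fun i => N * y i - latticePoint (N ^ 2) k i)
  -- Exchanging the sums regroups the network output by sample cells: a convex combination, with
  -- weights `φ n`, of the interpolants `I n`.
  have hnet : ∀ y : EuclideanSpace ℝ (Fin d₂), ∑ j, (∑ n, a j n *
      b j n (fun m => (g : EuclideanSpace ℝ (Fin d₁) → ℝ) (s m)) 0) * q j y.ofLp 0 =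
      ∑ n, φ n * I n y := by
    intro y
    have h1 : ∀ j, ∑ n, a j n * b j n (fun m => (g : EuclideanSpace ℝ (Fin d₁) → ℝ) (s m)) 0 =
        ∑ n, (match e₁.symm j with
          | none => Γ g₀ 0
          | some k => v n (gridPoint (N ^ 2) N k)) * φ n := fun j =>
      Equiv.sum_comp eH.symm fun n => (match e₁.symm j with
          | none => Γ g₀ 0
          | some k => v n (gridPoint (N ^ 2) N k)) * φ n
    simp only [h1, q]
    rw [Equiv.sum_comp e₁.symm fun j => (∑ n, (match j with
          | none => Γ g₀ 0
          | some k => v n (gridPoint (N ^ 2) N k)) * φ n) * (match j with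
          | none => hat fun i : Fin d₂ => 0 * y.ofLp i - 0
          | some k => hat fun i => N * y.ofLp i - latticePoint (N ^ 2) k i),
      Fintype.sum_option]
    simp only [zero_mul, sub_zero, hat_zero, mul_one, I, mul_add, Finset.sum_add_distrib,
      Finset.sum_mul, Finset.mul_sum]
    congr 1
    · exact Finset.sum_congr rfl fun n _ => mul_comm _ _
    · rw [Finset.sum_comm]
      exact Finset.sum_congr rfl fun n _ => Finset.sum_congr rfl fun k _ => by ring
  have hmain := expectSup_one_sub_le (X := X') (φ := φ) (fun n => hat_nonneg _) hφ1 (u := Γ g)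
    (w := fun n => Γ (rep n)) (v := I) (η := η / N)
    (b := (2 * (η + 2 * Lu * |M 1|) + 2 * Lu + Lu * d₂) / N) (by positivity) (by positivity)
    (fun n hn => ?_) (fun n y => ?_) hX2
  · simp only [s] at hnet
    simp only [hnet]
    refine hmain.trans_eq (congrArg _ ?_)
    simp only [operatorErrorConst]
    rw [← hK, ← hη]
    ring
  · refine expectSup_one_le_of_holder hK0 hLΓ hN1 hX (fun y => ?_) (hΓ2 g (rep n))
    refine abs_sub_le_of_samples hLg hCg (h0 g g.2) (h0 _ (rep n).2) (hLip g g.2)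
      (hLip _ (rep n).2) hN (fun k => ?_) y
    simpa [s] using hrep g n hn (eδ k)
  · have h := abs_sub_sum_hat_le (v := v n) hLu (hV (rep n)) (fun y z => by
      simpa [v] using hΓ (rep n) y z) hN y
    rw [div_mul_eq_mul_div]
    refine le_trans (le_of_eq ?_) h
    simp only [I, v]
    congr 1
    ring

end Operator

/-! ### Sizes of the networks -/

theorem inv_pow_le_rpow_neg {x e : ℝ} (hx : 0 < x) (hx1 : x ≤ 1) {n : ℕ} (hn : n ≤ e) :
    x⁻¹ ^ n ≤ x ^ (-e) := by
  rw [inv_pow, ← Real.rpow_natCast, ← Real.rpow_neg hx.le]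
  exact Real.rpow_le_rpow_of_exponent_ge hx hx1 (by linarith)

/-- Because `2 * log 2 ≥ 1`, the logarithmic factors in the size bounds are at least `1` and can be
dropped. -/
theorem one_le_log_rpow_neg {x e : ℝ} (hx : 0 < x) (hx1 : x ≤ 1 / 2) (he : 2 ≤ e) :
    1 ≤ Real.log (x ^ (-e)) := by
  rw [Real.log_rpow hx]
  have h1 : Real.log x ≤ -Real.log 2 := by
    rw [← Real.log_inv]
    exact Real.log_le_log hx (by linarith)
  have h2 := Real.log_two_gt_d9
  nlinarith

/-- The constant in the size bounds; `A` is the proportionality factor between the resolution `N` of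
the lattices and `1 / ε`. -/
noncomputable def sizeConst (d₁ d₂ : ℕ) (A : ℝ) : ℝ :=
  2 * (12 * A ^ 2) ^ d₂ + (24 * A ^ 3) ^ d₁ + (4 * (2 * d₂ + 1) * (d₂ + 1) + 6) + 4 * A ^ 2 + 30 +
    16 * A ^ 4

/-- The sizes other than the branch width are fixed, powers of `N`, or polynomial in `Nδ`; `N ≤ 2 *
A / ε` leaves only exponents to compare. For instance `Nδ` is of order `ε^(-3 d₁)`, and `3 d₁ ≤ 4 d₁
d₂ + 2 d₁`. -/
theorem sizeBounds_of_resolution {d₁ d₂ N : ℕ} {A ε : ℝ} (hd₁ : 0 < d₁) (hd₂ : 0 < d₂) (hA : 1 ≤ A)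
    (hε0 : 0 < ε) (hε : ε ≤ 1 / 2) (hN : 1 ≤ N) (hNA : N ≤ 2 * A / ε) {N₁ Nδ : ℕ}
    (hN₁ : N₁ = (2 * N ^ 2 + 1) ^ d₂ + 1) (hNδ : Nδ = (2 * N ^ 3 + 1) ^ d₁) :
    SizeBounds (sizeConst d₁ d₂ A) d₁ d₂ ε (ε / 2) (ε / 2 / (2 * N₁)) N₁ Nδ (d₂ + 3) (2 * d₂ + 1)
      (4 * (2 * d₂ + 1) * (d₂ + 1) + 6) (Nδ + 3) ((2 * N ^ 4 + 1) ^ Nδ * (2 * Nδ + 1))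
      (4 * (2 * Nδ + 1) * (Nδ + 1) + 6) ((N : ℝ) ^ 2) ((N : ℝ) ^ 4) := by
  have hN1 : (1 : ℝ) ≤ N := by exact_mod_cast hN
  have hd₁' : (1 : ℝ) ≤ d₁ := by exact_mod_cast hd₁
  have hd₂' : (1 : ℝ) ≤ d₂ := by exact_mod_cast hd₂
  have hNδ3 : 3 ≤ Nδ := by
    rw [hNδ]
    calc 3 ≤ 2 * N ^ 3 + 1 := by have := Nat.one_le_pow 3 N hN; omega
      _ ≤ _ := Nat.le_self_pow hd₁.ne' _
  have hNδ3' : (3 : ℝ) ≤ Nδ := by exact_mod_cast hNδ3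
  have hp : ∀ k : ℕ, (2 * (N : ℝ) ^ k + 1) ≤ 3 * (N : ℝ) ^ k := fun k => by
    linarith [one_le_pow₀ (n := k) hN1]
  have hNt : ∀ k : ℕ, (N : ℝ) ^ k ≤ (2 * A) ^ k * ε⁻¹ ^ k := fun k => by
    rw [← mul_pow, ← div_eq_mul_inv]
    gcongr
  -- the summands of the constant
  have c1 : 0 ≤ 2 * (12 * A ^ 2) ^ d₂ := by positivity
  have c2 : 0 ≤ (24 * A ^ 3) ^ d₁ := by positivity
  have c3 : (0 : ℝ) ≤ 4 * (2 * d₂ + 1) * (d₂ + 1) + 6 := by positivity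
  have c4 : 0 ≤ 4 * A ^ 2 := by positivity
  have c5 : 0 ≤ 16 * A ^ 4 := by positivity
  have hC : 0 ≤ sizeConst d₁ d₂ A := by unfold sizeConst; positivity
  have hε1 : ε ≤ 1 := by linarith
  have htrunk : 1 ≤ (1 / 2 * (d₂ : ℝ) + 2 * d₂ ^ 2) * Real.log ((ε / 2) ^ (-2 : ℝ)) := by
    have h1 := one_le_log_rpow_neg (x := ε / 2) (e := 2) (by linarith) (by linarith) le_rfl
    have h2 : 1 ≤ 1 / 2 * (d₂ : ℝ) + 2 * d₂ ^ 2 := by nlinarith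
    exact one_le_mul_of_one_le_of_one_le h2 h1
  have hbranch : ∀ e : ℝ, 2 ≤ e → 2 * (Nδ : ℝ) ^ 2 ≤ (Nδ + 1 / 2 * (Nδ : ℝ) ^ 2) * Real.log Nδ +
      (2 * (Nδ : ℝ) ^ 2 + Nδ) * Real.log (ε ^ (-e)) := by
    intro e he
    have h1 := one_le_log_rpow_neg hε0 hε he
    have h2 : 0 ≤ (Nδ + 1 / 2 * (Nδ : ℝ) ^ 2) * Real.log Nδ :=
      mul_nonneg (by positivity) (Real.log_nonneg (by linarith))
    have h3 : 2 * (Nδ : ℝ) ^ 2 + Nδ ≤ (2 * (Nδ : ℝ) ^ 2 + Nδ) * Real.log (ε ^ (-e)) :=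
      le_mul_of_one_le_right (by positivity) h1
    linarith
  refine ⟨?_, ?_, ?_, ?_, ?_, ?_, ?_, ?_, ?_, ?_⟩
  · calc (N₁ : ℝ) = (2 * (N : ℝ) ^ 2 + 1) ^ d₂ + 1 := by rw [hN₁]; push_cast; ring
      _ ≤ 2 * (2 * (N : ℝ) ^ 2 + 1) ^ d₂ := by
        have : 1 ≤ (2 * (N : ℝ) ^ 2 + 1) ^ d₂ := one_le_pow₀ (by nlinarith)
        linarith
      _ ≤ 2 * (3 * ((2 * A) ^ 2 * ε⁻¹ ^ 2)) ^ d₂ := by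
        gcongr
        exact (hp 2).trans (by gcongr; exact hNt 2)
      _ = 2 * (12 * A ^ 2) ^ d₂ * ε⁻¹ ^ (2 * d₂) := by
        rw [pow_mul, mul_assoc 2, ← mul_pow]; ring
      _ ≤ sizeConst d₁ d₂ A * ε ^ (-(2 * d₂ : ℝ)) := by
        gcongr
        · unfold sizeConst; linarith
        · exact inv_pow_le_rpow_neg hε0 hε1 (by push_cast; exact le_rfl)
  · calc (Nδ : ℝ) = (2 * (N : ℝ) ^ 3 + 1) ^ d₁ := by rw [hNδ]; push_cast; ring
      _ ≤ (3 * ((2 * A) ^ 3 * ε⁻¹ ^ 3)) ^ d₁ := by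
        gcongr
        exact (hp 3).trans (by gcongr; exact hNt 3)
      _ = (24 * A ^ 3) ^ d₁ * ε⁻¹ ^ (3 * d₁) := by
        rw [pow_mul, ← mul_pow]; ring
      _ ≤ sizeConst d₁ d₂ A * ε ^ (-(4 * d₁ * d₂ + 2 * d₁ : ℝ)) := by
        gcongr
        · unfold sizeConst; linarith
        · exact inv_pow_le_rpow_neg hε0 hε1 (by push_cast; nlinarith)
  · calc ((d₂ + 3 : ℕ) : ℝ) ≤ sizeConst d₁ d₂ A := by
          unfold sizeConst; push_cast; nlinarith
      _ ≤ _ := le_mul_of_one_le_right hC htrunk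
  · unfold sizeConst; push_cast; nlinarith
  · calc ((4 * (2 * d₂ + 1) * (d₂ + 1) + 6 : ℕ) : ℝ) ≤ sizeConst d₁ d₂ A := by
          unfold sizeConst; push_cast; linarith
      _ ≤ _ := le_mul_of_one_le_right hC htrunk
  · calc (N : ℝ) ^ 2 ≤ 4 * A ^ 2 * (ε / 2)⁻¹ ^ 2 := by
          refine (hNt 2).trans ?_
          have h1 : ε⁻¹ ≤ (ε / 2)⁻¹ := inv_anti₀ (by linarith) (by linarith)
          calc (2 * A) ^ 2 * ε⁻¹ ^ 2 = 4 * A ^ 2 * ε⁻¹ ^ 2 := by ring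
            _ ≤ _ := by gcongr
      _ ≤ sizeConst d₁ d₂ A * (ε / 2) ^ (-(2 * d₂ : ℝ)) := by
        gcongr
        · unfold sizeConst; linarith
        · exact inv_pow_le_rpow_neg (by linarith) (by linarith) (by push_cast; linarith)
  · calc ((Nδ + 3 : ℕ) : ℝ) ≤ 30 * (2 * (Nδ : ℝ) ^ 2) := by push_cast; nlinarith
      _ ≤ _ := by
        refine mul_le_mul ?_ (hbranch _ (by linarith)) (by positivity) hC
        unfold sizeConst; linarith
  -- Since `ε₂⁻¹ = 4 N₁ / ε` dominates `8 N²`, the `(2 N⁴ + 1) ^ Nδ` branch hats number at most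
  -- `ε₂^(-2 Nδ)`, with room for a factor `2 ^ Nδ` absorbing the width of each; and `2 ≤ 4 d₁ - 2`.
  · have hε2 : (ε / 2 / (2 * N₁))⁻¹ ≥ 8 * (N : ℝ) ^ 2 := by
      have h1 : (N : ℝ) ^ 2 ≤ N₁ := by
        have : N ^ 2 ≤ N₁ := by
          rw [hN₁]
          have := Nat.le_self_pow hd₂.ne' (2 * N ^ 2 + 1)
          omega
        exact_mod_cast this
      have h2 : (0 : ℝ) < N₁ := lt_of_lt_of_le (by positivity) h1
      have e : (ε / 2 / (2 * N₁))⁻¹ = 4 * N₁ / ε := by field_simp; norm_num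
      rw [e, ge_iff_le, le_div_iff₀ hε0]
      nlinarith
    have hε2pos : 0 < ε / 2 / (2 * (N₁ : ℝ)) := by
      have : 0 < (ε / 2 / (2 * (N₁ : ℝ)))⁻¹ := lt_of_lt_of_le (by positivity) hε2
      exact inv_pos.1 this
    have hε2le : ε / 2 / (2 * (N₁ : ℝ)) ≤ 1 := by
      rw [← one_le_inv₀ hε2pos]
      nlinarith [one_le_pow₀ (n := 2) hN1]
    calc (((2 * N ^ 4 + 1) ^ Nδ * (2 * Nδ + 1) : ℕ) : ℝ)
        = (2 * (N : ℝ) ^ 4 + 1) ^ Nδ * (2 * Nδ + 1) := by push_cast; ring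
      _ ≤ (3 * (N : ℝ) ^ 4) ^ Nδ * (3 * 2 ^ Nδ) := by
        have h1 : (Nδ : ℝ) ≤ 2 ^ Nδ := by exact_mod_cast Nat.lt_two_pow_self.le
        gcongr
        · exact hp 4
        · linarith
      _ = 3 * (6 * (N : ℝ) ^ 4) ^ Nδ := by
        rw [show 6 * (N : ℝ) ^ 4 = 3 * (N : ℝ) ^ 4 * 2 by ring, mul_pow (3 * (N : ℝ) ^ 4)]; ring
      _ ≤ 30 * ((8 * (N : ℝ) ^ 2) ^ 2) ^ Nδ := by
        gcongr
        · norm_num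
        · nlinarith [show 0 ≤ (N : ℝ) ^ 4 by positivity]
      _ ≤ 30 * (ε / 2 / (2 * (N₁ : ℝ)))⁻¹ ^ (2 * Nδ) := by
        rw [pow_mul]
        gcongr
      _ ≤ sizeConst d₁ d₂ A * (ε / 2 / (2 * N₁)) ^ (-((4 * d₁ - 2) * Nδ : ℝ)) := by
        gcongr
        · unfold sizeConst; linarith
        · exact inv_pow_le_rpow_neg hε2pos hε2le (by push_cast; nlinarith)
  · calc ((4 * (2 * Nδ + 1) * (Nδ + 1) + 6 : ℕ) : ℝ) ≤ 30 * (2 * (Nδ : ℝ) ^ 2) := by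
          push_cast; nlinarith
      _ ≤ _ := by
        refine mul_le_mul ?_ (hbranch _ (by linarith)) (by positivity) hC
        unfold sizeConst; linarith
  · calc (N : ℝ) ^ 4 ≤ 16 * A ^ 4 * ε⁻¹ ^ 4 := (hNt 4).trans_eq (by ring)
      _ ≤ sizeConst d₁ d₂ A * ε ^ (-(Nδ * (2 * d₂ + 1) : ℝ)) := by
        gcongr
        · unfold sizeConst; linarith
        · have h1 : (3 : ℝ) * 3 ≤ Nδ * (2 * d₂ + 1) := by
            gcongr
            linarith
          exact inv_pow_le_rpow_neg hε0 hε1 (by push_cast; linarith)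

/-! ### Choice of the resolution and conclusion -/

theorem mainTheorem2 (d₁ d₂ : ℕ) (hd₁ : 0 < d₁) (hd₂ : 0 < d₂)
    (T : ℝ) (hT : 0 < T)
    -- constants of the moment and tail assumptions
    (M : ℝ → ℝ) (α c CT r₀ : ℝ) (hα : 0 < α) (hc : 0 < c) (hCT : 0 < CT) (hr₀ : 0 ≤ r₀)
    -- constants of the growth and Lipschitz assumptions
    (Cg p Lg Lu LΓ : ℝ) (hCg : 0 < Cg) (hp : 0 < p) (hLg : 0 < Lg) (hLu : 0 < Lu)
    (hLΓ : 0 ≤ LΓ) :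
    ∃ C : ℝ, 0 < C ∧
    ∀ (Ω : Type*) [mΩ : MeasurableSpace Ω] (P : Measure Ω) [IsProbabilityMeasure P]
      (𝓕 : Filtration (Icc (0 : ℝ) T) mΩ) (_ : UsualConditions P 𝓕)
      -- the state processes of the input space and of the output space
      (x : EuclideanSpace ℝ (Fin d₁)) (X : Icc (0 : ℝ) T → Ω → EuclideanSpace ℝ (Fin d₁))
      (_ : IsStateProcess P 𝓕 M α c CT r₀ x X)
      (x' : EuclideanSpace ℝ (Fin d₂)) (X' : Icc (0 : ℝ) T → Ω → EuclideanSpace ℝ (Fin d₂))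
      (_ : IsStateProcess P 𝓕 M α c CT r₀ x' X')
      -- the input space
      (𝒢 : Set (EuclideanSpace ℝ (Fin d₁) → ℝ)) (_ : 𝒢 ⊆ spaceS2 P 𝓕 X)
      (_ : ∀ g ∈ 𝒢, ∀ y, |g y| ≤ Cg * (1 + ‖y‖ ^ p))
      (_ : ∀ g ∈ 𝒢, ∀ y z, |g y - g z| ≤ Lg * ‖y - z‖)
      -- the output space
      (𝒰 : Set (EuclideanSpace ℝ (Fin d₂) → ℝ)) (_ : 𝒰 ⊆ spaceS2 P 𝓕 X')
      (_ : ∀ v ∈ 𝒰, ∀ y z, |v y - v z| ≤ Lu * ‖y - z‖)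
      (ε : ℝ) (_ : 0 < ε),
    -- the architecture and the sample points
    ∃ (N₁ Nδ L₁ p₁ K₁ L₂ p₂ K₂ H w : ℕ) (κ₁ κ₂ : ℝ)
      (s : Fin Nδ → EuclideanSpace ℝ (Fin d₁)),
      0 < N₁ ∧ 0 < Nδ ∧ 0 < H ∧ 0 < w ∧ H * w ≤ p₂ ∧
      (ε ≤ 1 / 2 → SizeBounds C d₁ d₂ ε (ε / 2) (ε / 2 / (2 * N₁))
        N₁ Nδ L₁ p₁ K₁ L₂ p₂ K₂ κ₁ κ₂) ∧
      ∀ ΓA : 𝒢 → 𝒰,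
        (∀ g₁ g₂ : 𝒢,
          normS2 P X' (fun y => (ΓA g₁ : EuclideanSpace ℝ (Fin d₂) → ℝ) y -
              (ΓA g₂ : EuclideanSpace ℝ (Fin d₂) → ℝ) y) ^ 2 ≤
            ENNReal.ofReal (LΓ ^ 2) *
              (normS2 P X (fun y => (g₁ : EuclideanSpace ℝ (Fin d₁) → ℝ) y -
                  (g₂ : EuclideanSpace ℝ (Fin d₁) → ℝ) y) +
                normS2 P X (fun y => (g₁ : EuclideanSpace ℝ (Fin d₁) → ℝ) y -
                  (g₂ : EuclideanSpace ℝ (Fin d₁) → ℝ) y) ^ 2)) →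
        ∃ (q : Fin N₁ → (Fin d₂ → ℝ) → (Fin 1 → ℝ))
          (a : Fin N₁ → Fin H → ℝ) (b : Fin N₁ → Fin H → (Fin Nδ → ℝ) → (Fin 1 → ℝ)),
          (∀ k, q k ∈ FNN d₂ 1 L₁ p₁ K₁ κ₁ 1) ∧
          (∀ k n, b k n ∈ FNN Nδ 1 L₂ w K₂ κ₂ 1) ∧
          ⨆ g : 𝒢, expectSup P X' 1 (fun y =>
              (ΓA g : EuclideanSpace ℝ (Fin d₂) → ℝ) y -
                ∑ k, (∑ n, a k n *
                  b k n (fun m => (g : EuclideanSpace ℝ (Fin d₁) → ℝ) (s m)) 0) *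
                  q k y.ofLp 0) ≤ ENNReal.ofReal ε := by
  set D := operatorErrorConst d₁ d₂ M Cg Lg Lu LΓ with hD
  have hD0 : 0 ≤ D := operatorErrorConst_nonneg d₁ d₂ M hCg.le hLg.le hLu.le hLΓ
  -- The summand `D` makes the error `D / N` at most `ε`; the last summand gives `Cg + Lg * d₁ ≤ N`,
  -- hence the range condition on the samples.
  let A : ℝ := 1 + D + (Cg + Lg * d₁)
  have hA0 : 0 ≤ Cg + Lg * d₁ := by positivity
  have hA : 1 ≤ A := by simp only [A]; linarith
  refine ⟨sizeConst d₁ d₂ A, by unfold sizeConst; positivity, ?_⟩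
  intro Ω mΩ P _ 𝓕 _ x X hX x' X' hX' 𝒢 _ hgrowth hLip 𝒰 _ hULip ε hε
  -- Accuracies coarser than `1 / 2` are served by the network for `1 / 2`; then `A / ε₀ ≥ 1`, so
  -- rounding up at most doubles it.
  let ε₀ := min ε (1 / 2)
  have hε₀ : 0 < ε₀ := lt_min hε (by norm_num)
  have hε₀' : ε₀ ≤ 1 / 2 := min_le_right _ _
  let N := ⌈A / ε₀⌉₊
  have hNA : A / ε₀ ≤ N := Nat.le_ceil _
  have hA1 : 1 ≤ A / ε₀ := (one_le_div hε₀).2 (by linarith)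
  have hNA' : A ≤ N := by
    refine le_trans ?_ hNA
    rw [le_div_iff₀ hε₀]
    nlinarith
  have hN : 1 ≤ N := by exact_mod_cast hA.trans hNA'
  have hN0 : (0 : ℝ) < N := by exact_mod_cast hN
  have hN2 : (N : ℝ) ≤ 2 * A / ε₀ := by
    have h := Nat.ceil_lt_add_one (zero_le_one.trans hA1)
    calc (N : ℝ) ≤ A / ε₀ + 1 := h.le
      _ ≤ A / ε₀ + A / ε₀ := by linarith
      _ = 2 * A / ε₀ := by ring
  let N₁ := (2 * N ^ 2 + 1) ^ d₂ + 1
  let Nδ := (2 * N ^ 3 + 1) ^ d₁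
  let H := (2 * N ^ 4 + 1) ^ Nδ
  have e₁ : Option (Fin d₂ → Fin (2 * N ^ 2 + 1)) ≃ Fin N₁ :=
    Fintype.equivFinOfCardEq (by simp [N₁])
  have eδ : (Fin d₁ → Fin (2 * N ^ 3 + 1)) ≃ Fin Nδ := Fintype.equivFinOfCardEq (by simp [Nδ])
  have eH : (Fin Nδ → Fin (2 * N ^ 4 + 1)) ≃ Fin H := Fintype.equivFinOfCardEq (by simp [H])
  refine ⟨N₁, Nδ, d₂ + 3, 2 * d₂ + 1, 4 * (2 * d₂ + 1) * (d₂ + 1) + 6, Nδ + 3,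
    H * (2 * Nδ + 1), 4 * (2 * Nδ + 1) * (Nδ + 1) + 6, H, 2 * Nδ + 1, (N : ℝ) ^ 2, (N : ℝ) ^ 4,
    fun m => gridPoint (N ^ 3) ((N : ℝ) ^ 2) (eδ.symm m), by positivity, by positivity,
    by positivity, by positivity, le_rfl, fun hε1 => ?_, fun ΓA hΓA => ?_⟩
  · have e : ε₀ = ε := min_eq_left hε1
    exact sizeBounds_of_resolution hd₁ hd₂ hA hε hε1 hN (e ▸ hN2) rfl rfl
  · obtain ⟨q, a, b, hq, hb, hsup⟩ := exists_operator_network hT.le hCg.le hLg.le hLu.le hLΓ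
      (hX.moments 6 (by norm_num)) (hX'.moments 1 one_pos) (hX'.moments 2 two_pos)
      -- The growth bound at the origin, where `0 ^ p = 0` because `p ≠ 0`.
      (fun g hg => by simpa [Real.zero_rpow hp.ne'] using hgrowth g hg 0) hLip hN
      (by
        have h1 : Cg + Lg * (d₁ * N) ≤ (Cg + Lg * d₁) * N := by nlinarith [hA.trans hNA']
        have h2 : Cg + Lg * d₁ ≤ N := by linarith
        nlinarith) e₁ eδ eH
      (fun g => (ΓA g : EuclideanSpace ℝ (Fin d₂) → ℝ)) (fun g => hULip _ (ΓA g).2) hΓA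
    refine ⟨q, a, b, hq, hb, hsup.trans (ENNReal.ofReal_le_ofReal ?_)⟩
    rw [div_le_iff₀ hN0]
    rw [div_le_iff₀ hε₀] at hNA
    have h3 : ε₀ ≤ ε := min_le_left _ _
    nlinarith
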